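/- Let $k$ be a field. For an affine group scheme $G$ over $k$ let $\mathrm{Rep}_k(G)$ be the category of finite-dimensional $k$-linear representations of $G$, that is, of finite-dimensional $k$-vector spaces $V$ together with $R$-linear actions of $G(R)$ on $R\otimes_k V$, functorial in the commutative $k$-algebra $R$. Let $\varphi\colon H\to G$ be a homomorphism of affine group schemes over $k$, and let $\varphi^\#\colon \mathrm{Rep}_k(G)\to\mathrm{Rep}_k(H)$ be the restriction functor. Assume that $\varphi^\#$ has a faithful right adjoint $\varphi_\#\colon \mathrm{Rep}_k(H)\to\mathrm{Rep}_k(G)$ such that $H$ acts trivially on $\varphi^\#(\varphi_\#(\mathbb 1))$, where $\mathbb 1$ is the trivial one-dimensional representation of $H$. Then $\varphi$ is a closed immersion and is normal (for every $k$-scheme $T$, the image of $H(T)$ in $G(T)$ is a normal subgroup). Moreover, $\varphi$ has a cokernel in the category of affine group schemes over $k$, and if $\pi\colon G\to Q$ is any such cokernel, then the restriction functor $\pi^\#\colon\mathrm{Rep}_k(Q)\to\mathrm{Rep}_k(G)$ is fully faithful and its essential image consists exactly of those representations of $G$ on which $H$ acts trivially. In other words, $\pi^\#$ identifies $\mathrm{Rep}_k(Q)$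 with the full subcategory of $\mathrm{Rep}_k(G)$ of representations on which $H$ acts trivially. -/

import Mathlib

open CategoryTheory CategoryTheory.Limits AlgebraicGeometry TensorProduct
open scoped MonObj

universe u

noncomputable section

/- Group schemes over a field `k` are Mathlib's group objects in the category
`Over (Spec (.of k))` of `k`-schemes; such a group scheme `G` is affine when `IsAffine G.left`. -/

namespace AffineGroupScheme

variable {k : Type u} [Field k]

/-- `Spec R` as a `k`-scheme, for a commutative `k`-algebra `R`. -/
abbrev specOver (k : Type u) [Field k] (R : Type u) [CommRing R] [Algebra k R] :
    Over (Spec (.of k)) :=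
  Over.mk (Spec.map (CommRingCat.ofHom (algebraMap k R)))

/-- The morphism of `k`-schemes `Spec S ⟶ Spec R` given by a homomorphism `R →ₐ[k] S`. -/
abbrev specOverMap {R S : Type u} [CommRing R] [Algebra k R] [CommRing S] [Algebra k S]
    (f : R →ₐ[k] S) : specOver k S ⟶ specOver k R :=
  Over.homMk (Spec.map (CommRingCat.ofHom f.toRingHom)) (by
    simp only [Over.mk_left, Over.mk_hom, ← Spec.map_comp, ← CommRingCat.ofHom_comp]
    congr 2
    exact f.comp_algebraMap)

/-- A finite-dimensional `k`-linear representation of a `k`-group scheme `G`: a finite-dimensional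
`k`-vector space `V`, and for each commutative `k`-algebra `R` an `R`-linear action of the group
`G(R)` on `R ⊗ V`, functorially in `R`. -/
structure FDRep (G : Over (Spec (.of k))) [GrpObj G] where
  /-- the underlying vector space -/
  V : Type u
  [addCommGroup : AddCommGroup V]
  [module : Module k V]
  [finite : Module.Finite k V]
  /-- the action of `G(R)` on `R ⊗ V` -/
  ρ (R : Type u) [CommRing R] [Algebra k R] : (specOver k R ⟶ G) →* Module.End R (R ⊗[k] V)
  /-- functoriality in `R` -/
  ρ_map {R S : Type u} [CommRing R] [Algebra k R] [CommRing S] [Algebra k S] (f : R →ₐ[k] S)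
    (g : specOver k R ⟶ G) (x : R ⊗[k] V) :
    ρ S (specOverMap f ≫ g) (f.toLinearMap.rTensor V x) = f.toLinearMap.rTensor V (ρ R g x)

attribute [instance] FDRep.addCommGroup FDRep.module FDRep.finite

namespace FDRep

section

variable {G : Over (Spec (.of k))} [GrpObj G]

/-- A morphism of representations: a `k`-linear map whose base change to each commutative
`k`-algebra `R` commutes with the action of `G(R)`. -/
@[ext]
structure Hom (M N : FDRep G) where
  /-- the underlying linear map -/
  toLinearMap : M.V →ₗ[k] N.V
  comm (R : Type u) [CommRing R] [Algebra k R] (g : specOver k R ⟶ G) (x : R ⊗[k] M.V) :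
    toLinearMap.baseChange R (M.ρ R g x) = N.ρ R g (toLinearMap.baseChange R x)

/-- The category `Rep_k(G)` of finite-dimensional representations of `G`. -/
instance : Category (FDRep G) where
  Hom := Hom
  id M := ⟨LinearMap.id, fun R _ _ g x => by simp⟩
  comp f g := ⟨g.toLinearMap ∘ₗ f.toLinearMap, fun R _ _ h x => by
    simp only [LinearMap.baseChange_comp, LinearMap.comp_apply, f.comm, g.comm]⟩

/-- `G` acts trivially on `M`. -/
def IsTrivial (M : FDRep G) : Prop :=
  ∀ (R : Type u) [CommRing R] [Algebra k R] (g : specOver k R ⟶ G), M.ρ R g = 1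

variable (G) in
/-- The unit object of `Rep_k(G)`: the vector space `k` with the trivial action. -/
def unit : FDRep G where
  V := k
  ρ _ _ _ := 1
  ρ_map _ _ _ := rfl

end

/-- The restriction functor `Rep_k(G) ⥤ Rep_k(H)` along a homomorphism `φ : H ⟶ G` of group
schemes: `h ∈ H(R)` acts as `φ(h) ∈ G(R)`. -/
def res {G H : Over (Spec (.of k))} [GrpObj G] [GrpObj H] (φ : H ⟶ G) [IsMonHom φ] :
    FDRep G ⥤ FDRep H where
  obj M :=
    { V := M.V
      ρ := fun R _ _ => (M.ρ R).comp (IsMonHom.monoidHom φ (specOver k R))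
      ρ_map := fun f g x => by
        have := M.ρ_map f (g ≫ φ) x
        simpa using this }
  map f := ⟨f.toLinearMap, fun R _ _ g x => f.comm R (g ≫ φ) x⟩

end FDRep

/-- `π : G ⟶ Q` is a cokernel of `φ : H ⟶ G` in the category of affine group schemes over `k`:
the composite `H ⟶ G ⟶ Q` is trivial, and each homomorphism from `G` to an affine group scheme
that is trivial on `H` factors uniquely, as a homomorphism, through `π`. -/
structure IsCokernel {H G Q : Over (Spec (.of k))} [GrpObj H] [GrpObj G] [GrpObj Q]
    (φ : H ⟶ G) (π : G ⟶ Q) : Prop where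
  isAffine : IsAffine Q.left
  isMonHom : IsMonHom π
  comp_eq_one : φ ≫ π = 1
  existsUnique_fac (T : Over (Spec (.of k))) [GrpObj T] [IsAffine T.left] (ψ : G ⟶ T)
    [IsMonHom ψ] (hψ : φ ≫ ψ = 1) : ∃! χ : Q ⟶ T, IsMonHom χ ∧ π ≫ χ = ψ

end AffineGroupScheme

end

noncomputable section

/-! ### Coordinate Hopf algebras of affine group schemes -/

namespace AffineGroupScheme

variable {k : Type u} [Field k]

open WithConv

/-! Write `A → B` for the map of coordinate Hopf algebras of `φ`, and `E` for `ind 𝟙`.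

Closed immersion. Since `ind` is faithful, the counit `res (ind V) ⟶ V` is an epimorphism, hence
surjective, so every representation of `H` is a quotient of a restricted one (`ResCoversReps`). A
matrix coefficient of a quotient of a restricted representation is the image of an element of `A`.
Matrix coefficients span `B`, so `A → B` is surjective.

Normality. The key is that `H` is exactly the kernel of `G` acting on `E`. An `H`-invariant
functional on a representation `X` of `G` is a map `res X ⟶ 𝟙`, so by adjunction it factors through
a `G`-map `X ⟶ E`; a point of `G` acting trivially on `E` therefore preserves every such functional
(`invariant_of_adjunction`). Conversely, a point preserving all of them commutes with all
`H`-equivariant maps between representations of `G`, because these are the `H`-invariant functionals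
on `X ⊗ W*`. Applied to a map from some `X` onto a subspace of the ideal `I = ker (A → B)` that
contains a given `a ∈ I`, and combined with the vanishing of the counit on `I`, this forces the
point to kill `a`, so the point lies in `H` (`Coord.eq_zero_of_invariant`). As `H` acts trivially on
`E`, so do its conjugates, and a kernel contains them.

Cokernel. The functions on `G` with `a(x h y) = a(x y)` form a Hopf subalgebra `C` of `A`. Every
homomorphism from `G` to an affine group scheme that is trivial on `H` pulls functions back into
`C`, so the group scheme of `C` is a cokernel, and any other is isomorphic to it. Restriction from
it is full because `C → A` is injective. If `H` acts trivially on a representation of `G`, its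
matrix coefficients lie in `C`, so the representation descends. -/

/-- A coordinate Hopf algebra `A` of a group scheme `G`: a multiplicative and functorial
identification of `G(R)` with the algebra homomorphisms `A →ₐ[k] R`, such that the identity of `A`
corresponds to an isomorphism of schemes. -/
structure Coord (G : Over (Spec (.of k))) [GrpObj G] (A : Type u) [CommRing A]
    [HopfAlgebra k A] where
  /-- the `R`-point of `G` given by an algebra homomorphism `A →ₐ[k] R` -/
  pt (R : Type u) [CommRing R] [Algebra k R] : WithConv (A →ₐ[k] R) ≃* (specOver k R ⟶ G)
  pt_comp {R S : Type u} [CommRing R] [Algebra k R] [CommRing S] [Algebra k S] (f : R →ₐ[k] S)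
    (x : WithConv (A →ₐ[k] R)) : pt S (toConv (f.comp x.ofConv)) = specOverMap f ≫ pt R x
  isIso : IsIso (pt A (toConv (AlgHom.id k A)))

/-- The coordinate Hopf algebra of the spectrum of a Hopf algebra. -/
def Coord.spec (A : Type u) [CommRing A] [HopfAlgebra k A] :
    letI : GrpObj (specOver k A) := instGrpObjSpecAsOverSpec (R := .of k) (A := .of A)
    Coord (specOver k A) A :=
  letI : GrpObj (specOver k A) := instGrpObjSpecAsOverSpec (R := .of k) (A := .of A)
  { pt := fun R _ _ => Spec.mapMulEquiv (R := k) (S := A) (T := R)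
    pt_comp := fun f x => by
      ext1
      change Spec.map _ = Spec.map _ ≫ Spec.map _
      rw [← Spec.map_comp]
      rfl
    isIso := by
      convert! (inferInstance : IsIso (𝟙 (specOver k A)))
      ext1
      exact Spec.map_id _ }

/-- Transport of coordinates along an isomorphism of group schemes. -/
def Coord.ofIso {G G' : Over (Spec (.of k))} [GrpObj G] [GrpObj G'] {A : Type u} [CommRing A]
    [HopfAlgebra k A] (c : Coord G A) (e : G ≅ G') [IsMonHom e.hom] : Coord G' A where
  pt R _ _ := (c.pt R).trans (Hom.mulEquivCongrRight e _)
  pt_comp f x := by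
    change c.pt _ _ ≫ e.hom = _ ≫ c.pt _ _ ≫ e.hom
    rw [c.pt_comp, Category.assoc]
  isIso := by
    have := c.isIso
    change IsIso (c.pt _ _ ≫ e.hom)
    infer_instance

theorem Coord.exists_of_isAffine (G : Over (Spec (.of k))) [GrpObj G] [IsAffine G.left] :
    ∃ (A : Type u) (_ : CommRing A) (_ : HopfAlgebra k A), Nonempty (Coord G A) := by
  obtain ⟨A, ⟨e⟩⟩ := (essImage_hopfSpec (G := Grp.mk G)).2 ‹_›
  let _ : GrpObj (specOver k A.unop) :=
    instGrpObjSpecAsOverSpec (R := .of k) (A := .of A.unop)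
  let e' : specOver k A.unop ≅ G := (Grp.forget _).mapIso e
  have : IsMonHom e'.hom := e.hom.hom.isMonHom_hom
  exact ⟨A.unop, inferInstance, inferInstance, ⟨(Coord.spec (k := k) A.unop).ofIso e'⟩⟩

end AffineGroupScheme

/-! ### Representations as matrices; quotients and epimorphisms -/

namespace AffineGroupScheme

variable {k : Type u} [Field k]

namespace FDRep

variable {G : Over (Spec (.of k))} [GrpObj G]

/-- A linear map is equivariant as soon as it commutes with the group action on `1 ⊗ v`. -/
theorem comm_of_one_tmul {M N : FDRep G} (F : M.V →ₗ[k] N.V) {R : Type u} [CommRing R]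
    [Algebra k R] (g : specOver k R ⟶ G)
    (h : ∀ v, F.baseChange R (M.ρ R g (1 ⊗ₜ v)) = N.ρ R g (1 ⊗ₜ F v)) (x : R ⊗[k] M.V) :
    F.baseChange R (M.ρ R g x) = N.ρ R g (F.baseChange R x) := by
  induction x with
  | zero => simp
  | add x y hx hy => simp [hx, hy]
  | tmul r v =>
    have : r ⊗ₜ[k] v = r • (1 ⊗ₜ[k] v) := by simp [TensorProduct.smul_tmul']
    rw [this, map_smul, map_smul, map_smul, map_smul, h, LinearMap.baseChange_tmul]

theorem ρ_map_one_tmul (M : FDRep G) {R S : Type u} [CommRing R] [Algebra k R] [CommRing S]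
    [Algebra k S] (f : R →ₐ[k] S) (g : specOver k R ⟶ G) (v : M.V) :
    M.ρ S (specOverMap f ≫ g) (1 ⊗ₜ v) = f.toLinearMap.rTensor M.V (M.ρ R g (1 ⊗ₜ v)) := by
  simpa using M.ρ_map f g (1 ⊗ₜ v)

section Matrix

variable {n : Type*} [Fintype n] [DecidableEq n]

/-- The matrix of `g ∈ G(R)` acting on `R ⊗ V`, in the basis of `R ⊗ V` given by a basis
of `V`. -/
def matrix (M : FDRep G) (b : Module.Basis n k M.V) (R : Type u) [CommRing R] [Algebra k R] :
    (specOver k R ⟶ G) →* Matrix n n R :=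
  ((LinearMap.toMatrixAlgEquiv (Algebra.TensorProduct.basis R b) :
    Module.End R (R ⊗[k] M.V) ≃ₐ[R] _) : _ →* Matrix n n R).comp (M.ρ R)

theorem ρ_one_tmul_basis (M : FDRep G) (b : Module.Basis n k M.V) (R : Type u) [CommRing R]
    [Algebra k R] (g : specOver k R ⟶ G) (j : n) :
    M.ρ R g (1 ⊗ₜ b j) = ∑ i, M.matrix b R g i j ⊗ₜ b i := by
  have := (LinearMap.toMatrix_mulVec_repr (Algebra.TensorProduct.basis R b)
    (Algebra.TensorProduct.basis R b) (M.ρ R g) (1 ⊗ₜ b j))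
  apply (Algebra.TensorProduct.basis R b).repr.injective
  ext i
  rw [← congrFun this i]
  simp [Matrix.mulVec, dotProduct, matrix, LinearMap.toMatrixAlgEquiv, Finsupp.single_apply]

theorem matrix_map (M : FDRep G) (b : Module.Basis n k M.V) {R S : Type u} [CommRing R]
    [Algebra k R] [CommRing S] [Algebra k S] (f : R →ₐ[k] S) (g : specOver k R ⟶ G) :
    M.matrix b S (specOverMap f ≫ g) = (M.matrix b R g).map f := by
  ext i j
  have := M.ρ_map_one_tmul f g (b j)
  rw [ρ_one_tmul_basis, ρ_one_tmul_basis] at this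
  simpa [Finsupp.single_apply] using
    congrArg (fun x => (Algebra.TensorProduct.basis S b).repr x i) this

/-- The representation on `V` given by a functorial family of homomorphisms from `G(R)` to the
matrices over `R`, in terms of a basis of `V`. -/
def ofMatrix {V : Type u} [AddCommGroup V] [Module k V] (b : Module.Basis n k V)
    (D : ∀ (R : Type u) [CommRing R] [Algebra k R], (specOver k R ⟶ G) →* Matrix n n R)
    (hD : ∀ {R S : Type u} [CommRing R] [Algebra k R] [CommRing S] [Algebra k S] (f : R →ₐ[k] S)
      (g : specOver k R ⟶ G), D S (specOverMap f ≫ g) = (D R g).map f) : FDRep G where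
  V := V
  finite := .of_basis b
  ρ R _ _ := ((Matrix.toLinAlgEquiv (Algebra.TensorProduct.basis R b) :
    Matrix n n R ≃ₐ[R] _) : Matrix n n R →* Module.End R (R ⊗[k] V)).comp (D R)
  ρ_map {R S} _ _ _ _ f g x := by
    induction x with
    | zero => simp
    | add x y hx hy => simp only [map_add, hx, hy]
    | tmul r v =>
      induction b.mem_span v using Submodule.span_induction with
      | zero => simp
      | add x y _ _ hx hy => simp only [TensorProduct.tmul_add, map_add, hx, hy]
      | smul c x _ hx => simp only [TensorProduct.tmul_smul, map_smul, hx, 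
          LinearMap.map_smul_of_tower]
      | mem x hx =>
        obtain ⟨j, rfl⟩ := hx
        have e1 : r ⊗ₜ[k] b j = r • Algebra.TensorProduct.basis R b j := by
          simp [TensorProduct.smul_tmul']
        have e2 : f r ⊗ₜ[k] b j = f r • Algebra.TensorProduct.basis S b j := by
          simp [TensorProduct.smul_tmul']
        simp only [LinearMap.rTensor_tmul, AlgHom.toLinearMap_apply, MonoidHom.comp_apply,
          MonoidHom.coe_coe, hD]
        rw [e1, e2, map_smul, map_smul]
        simp only [Matrix.toLinAlgEquiv_self]
        simp [Finset.smul_sum, TensorProduct.smul_tmul']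

theorem ofMatrix_ρ_one_tmul {V : Type u} [AddCommGroup V] [Module k V] (b : Module.Basis n k V)
    (D : ∀ (R : Type u) [CommRing R] [Algebra k R], (specOver k R ⟶ G) →* Matrix n n R)
    (hD : ∀ {R S : Type u} [CommRing R] [Algebra k R] [CommRing S] [Algebra k S] (f : R →ₐ[k] S)
      (g : specOver k R ⟶ G), D S (specOverMap f ≫ g) = (D R g).map f)
    (R : Type u) [CommRing R] [Algebra k R] (g : specOver k R ⟶ G) (j : n) :
    (ofMatrix b D hD).ρ R g ((1 : R) ⊗ₜ[k] (b j : V)) = ∑ i, D R g i j ⊗ₜ b i := by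
  have : Matrix.toLinAlgEquiv (Algebra.TensorProduct.basis R b) (D R g) (1 ⊗ₜ b j) =
      ∑ i, D R g i j ⊗ₜ b i := by
    simpa [TensorProduct.smul_tmul'] using
      Matrix.toLinAlgEquiv_self (Algebra.TensorProduct.basis R b) (D R g) j
  exact this

end Matrix

section Quotient

/-- The quotient of a representation `N` along a split surjection `q` whose kernel is stable. -/
def quotient (N : FDRep G) {W : Type u} [AddCommGroup W] [Module k W] (q : N.V →ₗ[k] W)
    (s : W →ₗ[k] N.V) (hqs : q ∘ₗ s = LinearMap.id)
    (hq : ∀ (R : Type u) [CommRing R] [Algebra k R] (g : specOver k R ⟶ G),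
      q.baseChange R ∘ₗ N.ρ R g ∘ₗ (s ∘ₗ q).baseChange R = q.baseChange R ∘ₗ N.ρ R g) :
    FDRep G where
  V := W
  finite := .of_surjective q fun w => ⟨s w, LinearMap.congr_fun hqs w⟩
  ρ R _ _ :=
    { toFun := fun g => q.baseChange R ∘ₗ N.ρ R g ∘ₗ s.baseChange R
      map_one' := by
        rw [map_one]
        change q.baseChange R ∘ₗ LinearMap.id ∘ₗ s.baseChange R = _
        rw [LinearMap.id_comp, ← LinearMap.baseChange_comp, hqs, LinearMap.baseChange_id]
        rfl
      map_mul' := fun g h => by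
        have := congrArg (fun F => F ∘ₗ N.ρ R h ∘ₗ s.baseChange R) (hq R g)
        simp only [LinearMap.baseChange_comp] at this
        rw [map_mul]
        exact this.symm }
  ρ_map {R S} _ _ _ _ f g x := by
    have h1 (y : R ⊗[k] N.V) : q.baseChange S (f.toLinearMap.rTensor N.V y) =
        f.toLinearMap.rTensor W (q.baseChange R y) := by
      induction y with
      | zero => simp
      | add x y hx hy => simp only [map_add, hx, hy]
      | tmul r v => simp
    have h2 : s.baseChange S (f.toLinearMap.rTensor W x) =
        f.toLinearMap.rTensor N.V (s.baseChange R x) := by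
      induction x with
      | zero => simp
      | add x y hx hy => simp only [map_add, hx, hy]
      | tmul r v => simp
    change q.baseChange S (N.ρ S _ (s.baseChange S _)) = _
    rw [h2, N.ρ_map, h1]
    rfl

/-- An epimorphism of representations is surjective. -/
theorem surjective_of_epi {M N : FDRep G} (f : M ⟶ N) [Epi f] :
    Function.Surjective f.toLinearMap := by
  let U := LinearMap.range f.toLinearMap
  obtain ⟨s, hs⟩ := U.mkQ.exists_rightInverse_of_surjective U.range_mkQ
  have hU (v : N.V) : s (U.mkQ v) - v ∈ U := by
    have : U.mkQ (s (U.mkQ v) - v) = 0 := by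
      rw [map_sub]
      exact sub_eq_zero.2 (LinearMap.congr_fun hs _)
    exact (Submodule.Quotient.mk_eq_zero U).1 this
  obtain ⟨r, hr⟩ := f.toLinearMap.rangeRestrict.exists_rightInverse_of_surjective
    f.toLinearMap.range_rangeRestrict
  have hfr (v : U) : f.toLinearMap (r v) = v := congrArg Subtype.val (LinearMap.congr_fun hr v)
  -- The error of the section is written as `f ∘ t`. Equivariance of `f` then moves the action to
  -- `M`, where `U.mkQ ∘ f = 0` applies; this gives stability of the kernel after every base change.
  let t : N.V →ₗ[k] M.V := r ∘ₗ (s ∘ₗ U.mkQ - LinearMap.id).codRestrict U hU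
  have ht : s ∘ₗ U.mkQ = LinearMap.id + f.toLinearMap ∘ₗ t := by
    ext v
    simp [t, hfr]
  have hqf : U.mkQ ∘ₗ f.toLinearMap = 0 := by
    ext v
    simp [U]
  have hq (R : Type u) [CommRing R] [Algebra k R] (g : specOver k R ⟶ G) :
      U.mkQ.baseChange R ∘ₗ N.ρ R g ∘ₗ (s ∘ₗ U.mkQ).baseChange R =
        U.mkQ.baseChange R ∘ₗ N.ρ R g := by
    ext v
    have h1 : U.mkQ.baseChange R (f.toLinearMap.baseChange R (M.ρ R g (1 ⊗ₜ t v))) = 0 := by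
      rw [← LinearMap.comp_apply, ← LinearMap.baseChange_comp, hqf]
      simp
    rw [f.comm, LinearMap.baseChange_tmul] at h1
    have h2 : s (U.mkQ v) = v + f.toLinearMap (t v) := LinearMap.congr_fun ht v
    have : U.mkQ.baseChange R (N.ρ R g (1 ⊗ₜ s (U.mkQ v))) =
        U.mkQ.baseChange R (N.ρ R g (1 ⊗ₜ v)) := by
      rw [h2, TensorProduct.tmul_add, map_add, map_add, h1, add_zero]
    simpa using this
  let Q : FDRep G := N.quotient U.mkQ s hs hq
  let p : N ⟶ Q := ⟨U.mkQ, fun R _ _ g x => by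
    have := LinearMap.congr_fun (hq R g) x
    rw [LinearMap.baseChange_comp] at this
    exact this.symm⟩
  let z : N ⟶ Q := ⟨0, fun R _ _ g x => by simp⟩
  -- The projection onto the cokernel and the zero map agree after `f`, so the cokernel vanishes.
  have hpz : f ≫ p = f ≫ z := Hom.ext (hqf.trans (LinearMap.zero_comp _).symm)
  have h0 : U.mkQ = 0 := congrArg Hom.toLinearMap ((cancel_epi f).1 hpz)
  rw [← LinearMap.range_eq_top]
  change U = ⊤
  rw [← U.ker_mkQ, h0, LinearMap.ker_zero]

end Quotient
end FDRep

end AffineGroupScheme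

/-! ### Slices of tensors -/

/-- Contraction of the second factor of a tensor product with a functional. -/
def TensorProduct.sliceRight {k V W : Type*} [Field k] [AddCommGroup V] [Module k V]
    [AddCommGroup W] [Module k W] (ξ : W →ₗ[k] k) : V ⊗[k] W →ₗ[k] V :=
  (TensorProduct.rid k V).toLinearMap ∘ₗ ξ.lTensor V

/-- Contraction of the first factor of a tensor product with a functional. -/
def TensorProduct.sliceLeft {k V W : Type*} [Field k] [AddCommGroup V] [Module k V]
    [AddCommGroup W] [Module k W] (ξ : V →ₗ[k] k) : V ⊗[k] W →ₗ[k] W :=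
  (TensorProduct.lid k W).toLinearMap ∘ₗ ξ.rTensor W

namespace TensorProduct

variable {k V W : Type*} [Field k] [AddCommGroup V] [Module k V] [AddCommGroup W] [Module k W]

@[simp]
theorem sliceRight_tmul (ξ : W →ₗ[k] k) (v : V) (w : W) :
    sliceRight ξ (v ⊗ₜ[k] w) = ξ w • v := by
  simp [sliceRight]

@[simp]
theorem sliceLeft_tmul (ξ : V →ₗ[k] k) (v : V) (w : W) :
    sliceLeft ξ (v ⊗ₜ[k] w) = ξ v • w := by
  simp [sliceLeft]

/-- A tensor all of whose contractions lie in `S` comes from `S ⊗ W`. -/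
theorem mem_range_rTensor_subtype (S : Submodule k V) (t : V ⊗[k] W)
    (h : ∀ ξ : W →ₗ[k] k, sliceRight ξ t ∈ S) :
    t ∈ LinearMap.range (S.subtype.rTensor W) := by
  classical
  let β := Module.Basis.ofVectorSpace k W
  obtain ⟨c, rfl⟩ := eq_repr_basis_right β t
  refine Submodule.sum_mem _ fun i _ => ?_
  have hi : c i ∈ S := by
    have := h (β.coord i)
    simp only [Finsupp.sum, map_sum, sliceRight_tmul, Module.Basis.coord_apply,
      Module.Basis.repr_self, Finsupp.single_apply, ite_smul, one_smul, zero_smul] at this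
    by_cases hc : i ∈ c.support
    · simpa [Finset.sum_ite_eq', hc] using this
    · rw [Finsupp.notMem_support_iff.1 hc]
      exact S.zero_mem
  exact ⟨⟨c i, hi⟩ ⊗ₜ β i, by simp⟩

/-- A tensor all of whose contractions on either side lie in `S` comes from `S ⊗ S`. -/
theorem mem_range_map_subtype (S : Submodule k V) (t : V ⊗[k] V)
    (hr : ∀ ξ : V →ₗ[k] k, sliceRight ξ t ∈ S) (hl : ∀ ξ : V →ₗ[k] k, sliceLeft ξ t ∈ S) :
    t ∈ LinearMap.range (TensorProduct.map S.subtype S.subtype) := by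
  classical
  obtain ⟨t', rfl⟩ := mem_range_rTensor_subtype S t hr
  let β := Module.Basis.ofVectorSpace k S
  -- The retraction extends the coordinate functionals of `S` to `V`, where the hypothesis on left
  -- slices applies.
  obtain ⟨r, hrS⟩ := S.subtype.exists_leftInverse_of_injective S.ker_subtype
  have hrS' (x : S) : r x = x := LinearMap.congr_fun hrS x
  obtain ⟨c, rfl⟩ := eq_repr_basis_left β t'
  simp only [Finsupp.sum, map_sum]
  refine Submodule.sum_mem _ fun i _ => ?_
  have hi : c i ∈ S := by
    have := hl (β.coord i ∘ₗ r)
    simp only [Finsupp.sum, map_sum, LinearMap.rTensor_tmul, sliceLeft_tmul, LinearMap.comp_apply,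
      Submodule.subtype_apply, hrS', Module.Basis.coord_apply,
      Module.Basis.repr_self, Finsupp.single_apply, ite_smul, one_smul, zero_smul] at this
    by_cases hc : i ∈ c.support
    · simpa [Finset.sum_ite_eq', hc] using this
    · rw [Finsupp.notMem_support_iff.1 hc]
      exact S.zero_mem
  exact ⟨β i ⊗ₜ ⟨c i, hi⟩, by simp⟩

/-- The contractions of a tensor form a finite-dimensional space. -/
theorem finite_span_slices (t : V ⊗[k] W) :
    Module.Finite k (Submodule.span k (Set.range fun ξ : W →ₗ[k] k => sliceRight ξ t)) := by
  classical
  obtain ⟨s, rfl⟩ := exists_finset t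
  have hle : Submodule.span k (Set.range fun ξ : W →ₗ[k] k =>
      sliceRight ξ (∑ i ∈ s, i.1 ⊗ₜ[k] i.2)) ≤ Submodule.span k (s.image Prod.fst : Set V) := by
    rw [Submodule.span_le]
    rintro _ ⟨ξ, rfl⟩
    simp only [map_sum, sliceRight_tmul]
    refine Submodule.sum_mem _ fun i hi => Submodule.smul_mem _ _ (Submodule.subset_span ?_)
    simpa using ⟨i.2, hi⟩
  have : Module.Finite k (Submodule.span k (s.image Prod.fst : Set V)) := 
    Module.Finite.span_of_finite k (Finset.finite_toSet _)
  exact Submodule.finiteDimensional_of_le hle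

end TensorProduct

/-! ### Local finiteness of the coaction -/

namespace AffineGroupScheme

variable {k : Type u} [Field k]

/-- The entries of `e` are the matrix coefficients of a finite-dimensional comodule. -/
structure IsComatrix {B n : Type*} [Fintype n] [DecidableEq n] [CommRing B] [Bialgebra k B]
    (e : Matrix n n B) : Prop where
  comul (i j : n) : Coalgebra.comul (R := k) (e i j) = ∑ l, e i l ⊗ₜ[k] e l j
  counit (i j : n) : Coalgebra.counit (R := k) (e i j) = (1 : Matrix n n k) i j

open TensorProduct Coalgebra

section Coaction

variable {A B : Type*} [CommRing A] [CommRing B] [Bialgebra k A] [Bialgebra k B] (ψ : A →ₐc[k] B)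

/-- The coaction of `B` on `A` by right translation along a bialgebra homomorphism `A → B`. -/
def coaction : A →ₗ[k] A ⊗[k] B :=
  (ψ : A →ₗ[k] B).lTensor A ∘ₗ comul

theorem coaction_coassoc (a : A) :
    TensorProduct.assoc k A B B ((coaction ψ).rTensor B (coaction ψ a)) =
      (comul (R := k) (A := B)).lTensor A (coaction ψ a) := by
  have h1 (s : A ⊗[k] A) (y : A) : TensorProduct.assoc k A B B
      ((ψ : A →ₗ[k] B).lTensor A s ⊗ₜ ψ y) =
      (TensorProduct.map (ψ : A →ₗ[k] B) (ψ : A →ₗ[k] B)).lTensor A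
        (TensorProduct.assoc k A A A (s ⊗ₜ y)) := by
    induction s with
    | zero => simp
    | add x y hx hy => simp only [TensorProduct.add_tmul, map_add, hx, hy]
    | tmul x z => simp
  have h2 (t : A ⊗[k] A) : TensorProduct.assoc k A B B
      ((coaction ψ).rTensor B ((ψ : A →ₗ[k] B).lTensor A t)) =
      (TensorProduct.map (ψ : A →ₗ[k] B) (ψ : A →ₗ[k] B)).lTensor A
        (TensorProduct.assoc k A A A ((comul (R := k) (A := A)).rTensor A t)) := by
    induction t with
    | zero => simp
    | add x y hx hy => simp only [map_add, hx, hy]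
    | tmul x y => exact h1 (comul x) y
  have h3 (t : A ⊗[k] A) : (TensorProduct.map (ψ : A →ₗ[k] B) (ψ : A →ₗ[k] B)).lTensor A
        ((comul (R := k) (A := A)).lTensor A t) =
      (comul (R := k) (A := B)).lTensor A ((ψ : A →ₗ[k] B).lTensor A t) := by
    rw [← LinearMap.comp_apply, ← LinearMap.comp_apply, ← LinearMap.lTensor_comp,
      ← LinearMap.lTensor_comp]
    congr 2
    exact CoalgHomClass.map_comp_comul ψ
  change TensorProduct.assoc k A B B ((coaction ψ).rTensor B ((ψ : A →ₗ[k] B).lTensor A _)) = _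
  rw [h2, Coalgebra.coassoc_apply, h3]
  rfl

theorem sliceRight_counit_coaction (a : A) :
    sliceRight (counit (R := k) (A := B)) (coaction ψ a) = a := by
  have h (t : A ⊗[k] A) : sliceRight (counit (R := k) (A := B)) ((ψ : A →ₗ[k] B).lTensor A t) =
      TensorProduct.rid k A ((counit (R := k) (A := A)).lTensor A t) := by
    induction t with
    | zero => simp
    | add x y hx hy => simp only [map_add, hx, hy]
    | tmul x y => simp
  refine (h _).trans ?_
  rw [Coalgebra.lTensor_counit_comul]
  simp

/-- By coassociativity, two successive slices amount to one slice by a convolution product. Hence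
the slices of `a` form a subcomodule. -/
theorem sliceRight_coaction_sliceRight (ζ ξ : B →ₗ[k] k) (a : A) :
    sliceRight ζ (coaction ψ (sliceRight ξ (coaction ψ a))) =
      sliceRight (LinearMap.mul' k k ∘ₗ TensorProduct.map ζ ξ ∘ₗ comul) (coaction ψ a) := by
  have h1 (s : A ⊗[k] B) (y : B) : ξ y • sliceRight ζ s =
      sliceRight (LinearMap.mul' k k ∘ₗ TensorProduct.map ζ ξ)
        (TensorProduct.assoc k A B B (s ⊗ₜ y)) := by
    induction s with
    | zero => simp
    | add x y hx hy => simp only [TensorProduct.add_tmul, map_add, smul_add, hx, hy]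
    | tmul x z => simp [smul_smul, mul_comm]
  have h2 (t : A ⊗[k] B) : sliceRight ζ (coaction ψ (sliceRight ξ t)) =
      sliceRight (LinearMap.mul' k k ∘ₗ TensorProduct.map ζ ξ)
        (TensorProduct.assoc k A B B ((coaction ψ).rTensor B t)) := by
    induction t with
    | zero => simp
    | add x y hx hy => simp only [map_add, hx, hy]
    | tmul x y => simp [← h1]
  rw [h2, coaction_coassoc]
  change _ = TensorProduct.rid k A
    (((LinearMap.mul' k k ∘ₗ TensorProduct.map ζ ξ) ∘ₗ comul).lTensor A (coaction ψ a))
  rw [LinearMap.lTensor_comp]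
  rfl

/-- Local finiteness of the coaction: each element lies in a subspace with a finite basis on which
the coaction is given by a matrix, and which is spanned by translates of the element. -/
theorem exists_isComatrix (a : A) :
    ∃ (n : ℕ) (b : Fin n → A) (e : Matrix (Fin n) (Fin n) B),
      LinearIndependent k b ∧ a ∈ Submodule.span k (Set.range b) ∧
      (∀ j, coaction ψ (b j) = ∑ i, b i ⊗ₜ e i j) ∧ IsComatrix (k := k) e ∧
      ∀ j, ∃ ξ : B →ₗ[k] k, b j = sliceRight ξ (coaction ψ a) := by
  let W := Submodule.span k (Set.range fun ξ : B →ₗ[k] k => sliceRight ξ (coaction ψ a))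
  have : Module.Finite k W := finite_span_slices _
  -- Slices depend linearly on the functional, so they already form a subspace.
  have hW (w : A) (hw : w ∈ W) : ∃ ξ : B →ₗ[k] k, w = sliceRight ξ (coaction ψ a) := by
    induction hw using Submodule.span_induction with
    | zero => exact ⟨0, by simp [sliceRight]⟩
    | add x y _ _ hx hy =>
      obtain ⟨ξ, rfl⟩ := hx
      obtain ⟨ζ, rfl⟩ := hy
      exact ⟨ξ + ζ, by simp [sliceRight, LinearMap.lTensor_add]⟩
    | smul c x _ hx =>
      obtain ⟨ξ, rfl⟩ := hx
      exact ⟨c • ξ, by simp [sliceRight, LinearMap.lTensor_smul]⟩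
    | mem x hx =>
      obtain ⟨ξ, rfl⟩ := hx
      exact ⟨ξ, rfl⟩
  let β := Module.finBasis k W
  have hβ (w : W) : ∃ e : Fin _ → B, coaction ψ w = ∑ i, (β i : A) ⊗ₜ e i := by
    obtain ⟨t, ht⟩ := mem_range_rTensor_subtype W (coaction ψ w) fun ζ => by
      obtain ⟨ξ, hξ⟩ := hW w w.2
      rw [hξ, sliceRight_coaction_sliceRight]
      exact Submodule.subset_span ⟨_, rfl⟩
    obtain ⟨c, rfl⟩ := eq_repr_basis_left β t
    exact ⟨c, by rw [← ht, Finsupp.sum_fintype _ _ (by simp)]; simp⟩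
  choose e he using fun j => hβ (β j)
  obtain ⟨r, hr⟩ := W.subtype.exists_leftInverse_of_injective W.ker_subtype
  have hr' (x : W) : r x = x := LinearMap.congr_fun hr x
  have hLI : LinearIndependent k fun j => (β j : A) :=
    β.linearIndependent.map' W.subtype W.ker_subtype
  refine ⟨_, fun j => β j, Matrix.of fun i j => e j i, hLI, ?_, he, ⟨fun i j => ?_, fun i j => ?_⟩,
    fun j => hW _ (β j).2⟩
  · have ha : a ∈ W := Submodule.subset_span ⟨counit, sliceRight_counit_coaction ψ a⟩
    have := congrArg W.subtype (β.sum_repr ⟨a, ha⟩)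
    simp only [map_sum, map_smul, Submodule.subtype_apply] at this
    rw [← this]
    exact Submodule.sum_mem _ fun i _ => Submodule.smul_mem _ _ (Submodule.subset_span ⟨i, rfl⟩)
  -- Coassociativity and the counit axiom at `β j`, read off at the coefficient of `β i`, are the
  -- two comatrix identities.
  · have h1 := coaction_coassoc ψ (β j)
    rw [he] at h1
    simp only [map_sum, LinearMap.rTensor_tmul, he, LinearMap.lTensor_tmul,
      TensorProduct.sum_tmul, TensorProduct.assoc_tmul] at h1
    have h2 := congrArg (sliceLeft (β.coord i ∘ₗ r)) h1
    simpa [hr', Finsupp.single_apply] using h2.symm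
  · have h1 := sliceRight_counit_coaction ψ (β j : A)
    rw [he] at h1
    have h2 := congrArg (β.coord i ∘ₗ r) h1
    simpa [hr', Finsupp.single_apply, Matrix.one_apply, eq_comm] using h2

end Coaction

end AffineGroupScheme

/-! ### Points, convolution and homomorphisms of coordinate algebras -/

namespace AffineGroupScheme

variable {k : Type u} [Field k]

open MonoidalCategory CartesianMonoidalCategory TensorProduct Coalgebra WithConv
  Algebra.TensorProduct

section Convolution

variable {A : Type*} [CommRing A] [Bialgebra k A]

/-- The comultiplication is the product of the universal pair of points; identities multiplicative
on points become identities for `comul` when evaluated at this pair. -/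
theorem includeLeft_convMul_includeRight :
    (toConv includeLeft * toConv includeRight : WithConv (A →ₐ[k] A ⊗[k] A)).ofConv =
      Bialgebra.comulAlgHom k A := by
  ext a
  change (toConv includeLeft * toConv includeRight : WithConv (A →ₐ[k] A ⊗[k] A)) a = comul a
  rw [AlgHom.convMul_apply]
  generalize comul (R := k) a = t
  induction t with
  | zero => simp
  | add x y hx hy => simp only [map_add, hx, hy]
  | tmul x y => simp

theorem convOne_ofConv : (1 : WithConv (A →ₐ[k] k)).ofConv = Bialgebra.counitAlgHom k A := rfl

theorem comp_convMul {R S : Type*} [CommRing R] [Algebra k R] [CommRing S] [Algebra k S]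
    (f : R →ₐ[k] S) (x y : WithConv (A →ₐ[k] R)) :
    toConv (f.comp (x * y).ofConv) = toConv (f.comp x.ofConv) * toConv (f.comp y.ofConv) :=
  congrArg toConv (AlgHom.comp_convMul_distrib f x y)

variable {n : Type*} [Fintype n] [DecidableEq n]

/-- Evaluation of the matrix of a comodule at points is multiplicative. -/
def IsComatrix.eval {e : Matrix n n A} (he : IsComatrix (k := k) e) (R : Type*) [CommRing R]
    [Algebra k R] : WithConv (A →ₐ[k] R) →* Matrix n n R where
  toFun x := e.map x.ofConv
  map_one' := by
    ext i j
    change (1 : WithConv (A →ₐ[k] R)) (e i j) = _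
    rw [AlgHom.convOne_apply, he.counit, Matrix.one_apply, Matrix.one_apply]
    split_ifs <;> simp
  map_mul' x y := by
    ext i j
    change (x * y) (e i j) = _
    rw [AlgHom.convMul_apply, he.comul]
    simp [Matrix.mul_apply]

@[simp]
theorem IsComatrix.eval_apply {e : Matrix n n A} (he : IsComatrix (k := k) e) {R : Type*}
    [CommRing R] [Algebra k R] (x : WithConv (A →ₐ[k] R)) : he.eval R x = e.map x.ofConv := rfl

end Convolution

theorem exists_specOver_iso (X : Over (Spec (.of k))) [IsAffine X.left] :
    ∃ (R : Type u) (_ : CommRing R) (_ : Algebra k R), Nonempty (specOver k R ≅ X) := by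
  obtain ⟨A, ⟨e⟩⟩ := (essImage_algSpec (G := X)).2 ‹_›
  exact ⟨A.unop, inferInstance, inferInstance, ⟨e⟩⟩

namespace Coord

variable {G H : Over (Spec (.of k))} [GrpObj G] [GrpObj H] {A B : Type u} [CommRing A]
  [HopfAlgebra k A] [CommRing B] [HopfAlgebra k B] (c : Coord G A) (d : Coord H B)

/-- The universal point. -/
def univ : specOver k A ⟶ G := c.pt A (toConv (AlgHom.id k A))

instance : IsIso c.univ := c.isIso

theorem specOverMap_univ {R : Type u} [CommRing R] [Algebra k R] (f : A →ₐ[k] R) :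
    specOverMap f ≫ c.univ = c.pt R (toConv f) :=
  (c.pt_comp f (toConv (AlgHom.id k A))).symm

theorem isAffine (c : Coord G A) : IsAffine G.left :=
  have : IsIso (inv c.univ).left :=
    inferInstanceAs (IsIso ((Over.forget (Spec (.of k))).map (inv c.univ)))
  have : IsAffine (specOver k A).left := inferInstanceAs (IsAffine (Spec (.of A)))
  .of_isIso (inv c.univ).left

/-- The homomorphism of coordinate algebras given by a morphism of schemes. -/
def comap (f : H ⟶ G) : A →ₐ[k] B := ((c.pt B).symm (d.univ ≫ f)).ofConv

theorem univ_comp (f : H ⟶ G) : d.univ ≫ f = c.pt B (toConv (c.comap d f)) := by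
  simp [comap]

theorem pt_comp_hom (f : H ⟶ G) {R : Type u} [CommRing R] [Algebra k R]
    (x : WithConv (B →ₐ[k] R)) :
    d.pt R x ≫ f = c.pt R (toConv (x.ofConv.comp (c.comap d f))) := by
  rw [← toConv_ofConv x, ← d.specOverMap_univ, Category.assoc, c.univ_comp d, c.pt_comp]

/-- A morphism of schemes is determined by its homomorphism of coordinate algebras. -/
theorem hom_ext {f f' : H ⟶ G} (h : c.comap d f = c.comap d f') : f = f' := by
  rw [← cancel_epi d.univ, c.univ_comp, c.univ_comp, h]

/-- A morphism of schemes with given homomorphism of coordinate algebras. -/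
def homMk (ψ : A →ₐ[k] B) : H ⟶ G := inv d.univ ≫ c.pt B (toConv ψ)

@[simp]
theorem comap_homMk (ψ : A →ₐ[k] B) : c.comap d (c.homMk d ψ) = ψ := by
  simp [comap, homMk]

theorem comap_convMul (f : H ⟶ G) [IsMonHom f] {R : Type u} [CommRing R] [Algebra k R]
    (x y : WithConv (B →ₐ[k] R)) :
    toConv ((x * y).ofConv.comp (c.comap d f)) =
      toConv (x.ofConv.comp (c.comap d f)) * toConv (y.ofConv.comp (c.comap d f)) := by
  apply (c.pt R).injective
  rw [map_mul, ← c.pt_comp_hom d, ← c.pt_comp_hom d, ← c.pt_comp_hom d, map_mul, MonObj.mul_comp]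

theorem comap_convOne (f : H ⟶ G) [IsMonHom f] {R : Type u} [CommRing R] [Algebra k R] :
    toConv ((1 : WithConv (B →ₐ[k] R)).ofConv.comp (c.comap d f)) = 1 := by
  apply (c.pt R).injective
  rw [map_one, ← c.pt_comp_hom d, map_one, MonObj.one_comp]

/-- The bialgebra homomorphism of coordinate algebras given by a homomorphism of group schemes. -/
def comapBialgHom (f : H ⟶ G) [IsMonHom f] : A →ₐc[k] B :=
  .ofAlgHom (c.comap d f) (congrArg ofConv (c.comap_convOne d f (R := k))) (by
    have h := congrArg ofConv (c.comap_convMul d f (R := B ⊗[k] B) (toConv includeLeft)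
      (toConv includeRight))
    rw [includeLeft_convMul_includeRight] at h
    refine Eq.trans ?_ h.symm
    rw [← includeLeft_convMul_includeRight, AlgHom.comp_convMul_distrib]
    congr 2 <;> exact congrArg toConv (by ext; simp))

/-- A morphism of schemes given by a bialgebra homomorphism is a homomorphism of group schemes. -/
theorem isMonHom_of_comap (f : H ⟶ G) (ψ : A →ₐc[k] B) (h : c.comap d f = ψ) : IsMonHom f := by
  have hmul {R : Type u} [CommRing R] [Algebra k R] (x y : specOver k R ⟶ H) :
      (x * y) ≫ f = (x ≫ f) * (y ≫ f) := by
    obtain ⟨x, rfl⟩ := (d.pt R).surjective x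
    obtain ⟨y, rfl⟩ := (d.pt R).surjective y
    rw [← map_mul, c.pt_comp_hom d, c.pt_comp_hom d, c.pt_comp_hom d, ← map_mul, h]
    congr 1
    exact congrArg toConv (AlgHom.convMul_comp_bialgHom_distrib x y ψ)
  have : IsAffine H.left := d.isAffine
  -- The multiplication of `H` is the product of the two projections. These are points over the
  -- affine scheme `H ⊗ H`, so multiplicativity on points over algebras suffices.
  have hmul' (x y : (H ⊗ H) ⟶ H) : (x * y) ≫ f = (x ≫ f) * (y ≫ f) := by
    have : IsAffine (H ⊗ H).left := inferInstanceAs (IsAffine (pullback H.hom H.hom))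
    obtain ⟨R, _, _, ⟨e⟩⟩ := exists_specOver_iso (H ⊗ H)
    rw [← cancel_epi e.hom, ← Category.assoc, MonObj.comp_mul, hmul, MonObj.comp_mul,
      Category.assoc, Category.assoc]
  have hone : (1 : 𝟙_ _ ⟶ H) ≫ f = 1 := by
    have : IsAffine (𝟙_ (Over (Spec (.of k)))).left := inferInstanceAs (IsAffine (Spec (.of k)))
    obtain ⟨R, _, _, ⟨e⟩⟩ := exists_specOver_iso (𝟙_ (Over (Spec (.of k))))
    -- The image of `1` is an idempotent of a group, hence trivial.
    have h := hmul (1 : specOver k R ⟶ H) 1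
    rw [mul_one, left_eq_mul] at h
    rw [← cancel_epi e.hom, ← Category.assoc, MonObj.comp_one, h, MonObj.comp_one]
  refine ⟨?_, ?_⟩
  · rw [MonObj.one_eq_one, hone, MonObj.one_eq_one]
  · rw [MonObj.mul_eq_mul, hmul', Hom.mul_def]
    congr 1

theorem eval_pt_symm_comp {n : Type*} [Fintype n] [DecidableEq n] {e : Matrix n n A}
    (he : IsComatrix (k := k) e) {R S : Type u} [CommRing R] [Algebra k R] [CommRing S]
    [Algebra k S] (f : R →ₐ[k] S) (g : specOver k R ⟶ G) :
    (he.eval S).comp ((c.pt S).symm : _ →* _) (specOverMap f ≫ g) =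
      ((he.eval R).comp ((c.pt R).symm : _ →* _) g).map f := by
  obtain ⟨x, rfl⟩ := (c.pt R).surjective g
  rw [← c.pt_comp]
  ext i j
  simp

/-- The representation given by the matrix of a comodule. -/
def rep {n : Type*} [Fintype n] [DecidableEq n] {V : Type u} [AddCommGroup V] [Module k V]
    (b : Module.Basis n k V) {e : Matrix n n A} (he : IsComatrix (k := k) e) : FDRep G :=
  FDRep.ofMatrix b (fun R _ _ => (he.eval R).comp ((c.pt R).symm : _ →* _))
    (c.eval_pt_symm_comp he)

theorem rep_ρ_one_tmul {n : Type*} [Fintype n] [DecidableEq n] {V : Type u} [AddCommGroup V]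
    [Module k V] (b : Module.Basis n k V) {e : Matrix n n A} (he : IsComatrix (k := k) e)
    {R : Type u} [CommRing R] [Algebra k R] (x : WithConv (A →ₐ[k] R)) (j : n) :
    (c.rep b he).ρ R (c.pt R x) ((1 : R) ⊗ₜ[k] (b j : V)) = ∑ i, x.ofConv (e i j) ⊗ₜ b i := by
  have h := FDRep.ofMatrix_ρ_one_tmul b (fun R _ _ => (he.eval R).comp ((c.pt R).symm : _ →* _))
    (c.eval_pt_symm_comp he) R (c.pt R x) j
  simp only [MonoidHom.comp_apply, MonoidHom.coe_coe, MulEquiv.symm_apply_apply,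
    IsComatrix.eval_apply, Matrix.map_apply] at h
  exact h

section matrix

variable {n : Type*} [Fintype n] [DecidableEq n] (M : FDRep G) (b : Module.Basis n k M.V)

theorem matrix_pt {R : Type u} [CommRing R] [Algebra k R] (x : WithConv (A →ₐ[k] R)) :
    M.matrix b R (c.pt R x) = (M.matrix b A c.univ).map x.ofConv := by
  rw [← toConv_ofConv x, ← c.specOverMap_univ, M.matrix_map]

theorem isComatrix_matrix : IsComatrix (k := k) (M.matrix b A c.univ) where
  comul i j := by
    have h := map_mul (M.matrix b _)
      (c.pt _ (toConv includeLeft)) (c.pt (A ⊗[k] A) (toConv includeRight))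
    rw [← map_mul, matrix_pt, matrix_pt, matrix_pt, includeLeft_convMul_includeRight] at h
    simpa [Matrix.mul_apply] using congrFun (congrFun h i) j
  counit i j := by
    have h := map_one (M.matrix b k)
    rw [← map_one (c.pt k), matrix_pt, convOne_ofConv] at h
    simpa using congrFun (congrFun h i) j

end matrix

end Coord

end AffineGroupScheme

/-! ### Covering representations of `H`, and the closed immersion -/

namespace AffineGroupScheme

variable {k : Type u} [Field k]

open MonoidalCategory CartesianMonoidalCategory TensorProduct Coalgebra WithConv
  Algebra.TensorProduct

variable {G H : Over (Spec (.of k))} [GrpObj G] [GrpObj H] {A B : Type u} [CommRing A]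
  [HopfAlgebra k A] [CommRing B] [HopfAlgebra k B]

/-- Every representation of `H` is a quotient of the restriction of a representation of `G`. -/
def ResCoversReps (φ : H ⟶ G) : Prop :=
  ∀ V : FDRep H, ∃ (X : FDRep G) (p : X.V →ₗ[k] V.V), Function.Surjective p ∧
    ∀ (R : Type u) [CommRing R] [Algebra k R] (h : specOver k R ⟶ H) (x : R ⊗[k] X.V),
      p.baseChange R (X.ρ R (h ≫ φ) x) = V.ρ R h (p.baseChange R x)

/-- A right adjoint is faithful only if the counit is epi, and epimorphisms of representations are
surjective: the counit is the cover. -/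
theorem resCoversReps_of_adjunction (φ : H ⟶ G) [IsMonHom φ] {ind : FDRep H ⥤ FDRep G}
    (adj : FDRep.res φ ⊣ ind) [ind.Faithful] : ResCoversReps φ := fun V =>
  have := adj.counit_epi_of_R_faithful V
  ⟨ind.obj V, (adj.counit.app V).toLinearMap, FDRep.surjective_of_epi _, (adj.counit.app V).comm⟩

namespace Coord

variable (c : Coord G A) (d : Coord H B) (φ : H ⟶ G)

theorem isClosedImmersion (h : Function.Surjective (c.comap d φ)) : IsClosedImmersion φ.left := by
  have h1 : φ = inv d.univ ≫ specOverMap (c.comap d φ) ≫ c.univ := by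
    rw [c.specOverMap_univ, ← c.univ_comp d, IsIso.inv_hom_id_assoc]
  have : IsIso (inv d.univ).left :=
    inferInstanceAs (IsIso ((Over.forget (Spec (.of k))).map (inv d.univ)))
  have : IsIso c.univ.left :=
    inferInstanceAs (IsIso ((Over.forget (Spec (.of k))).map c.univ))
  have : IsClosedImmersion (specOverMap (c.comap d φ)).left :=
    IsClosedImmersion.spec_of_surjective _ h
  rw [h1, Over.comp_left, Over.comp_left]
  infer_instance

variable {φ}

theorem exists_cover_of_isComatrix (hφ : ResCoversReps φ) {n : Type} [Fintype n] [DecidableEq n]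
    {e : Matrix n n B} (he : IsComatrix (k := k) e) :
    ∃ (X : FDRep G) (p : X.V →ₗ[k] (n → k)), Function.Surjective p ∧
      ∀ (R : Type u) [CommRing R] [Algebra k R] (y : WithConv (B →ₐ[k] R)) (v : X.V),
        p.baseChange R (X.ρ R (d.pt R y ≫ φ) (1 ⊗ₜ v)) =
          ∑ l, p v l • ∑ i, y.ofConv (e i l) ⊗ₜ[k] (Pi.basisFun k n i) := by
  obtain ⟨X, p, hp, h⟩ := hφ (d.rep (Pi.basisFun k n) he)
  refine ⟨X, p, hp, fun R _ _ y v => ?_⟩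
  have h1 := h R (d.pt R y) (1 ⊗ₜ v)
  have h2 (w : n → k) : (d.rep (Pi.basisFun k n) he).ρ R (d.pt R y) ((1 : R) ⊗ₜ[k] w) =
      (∑ l, w l • ∑ i, y.ofConv (e i l) ⊗ₜ[k] (Pi.basisFun k n i) : R ⊗[k] (n → k)) := by
    have h3 : (1 : R) ⊗ₜ[k] w = ∑ l, w l • ((1 : R) ⊗ₜ[k] (Pi.basisFun k n l)) := by
      conv_lhs => rw [← (Pi.basisFun k n).sum_repr w]
      simp [TensorProduct.tmul_sum]
    let r : Module.End R (R ⊗[k] (n → k)) := (d.rep (Pi.basisFun k n) he).ρ R (d.pt R y)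
    have h4 (l : n) : r (1 ⊗ₜ Pi.basisFun k n l) = ∑ i, y.ofConv (e i l) ⊗ₜ Pi.basisFun k n i :=
      d.rep_ρ_one_tmul (Pi.basisFun k n) he y l
    change r (1 ⊗ₜ w) = _
    simp only [h3, map_sum, LinearMap.map_smul_of_tower, h4]
  exact h1.trans (h2 (p v))

/-- If `v` in the cover `X` lies over the `j`-th basis vector, the coefficient of `X` at `v` and the
functional `proj i ∘ p` restricts on `H` to `e i j`. -/
theorem mem_range_comap_of_isComatrix (hφ : ResCoversReps φ) {n : Type} [Fintype n] [DecidableEq n]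
    {e : Matrix n n B} (he : IsComatrix (k := k) e) (i j : n) :
    ∃ a, c.comap d φ a = e i j := by
  obtain ⟨X, p, hp, h⟩ := d.exists_cover_of_isComatrix hφ he
  obtain ⟨v, hv⟩ := hp (Pi.single j 1)
  have h1 := h B (toConv (AlgHom.id k B)) v
  have h2 : d.pt B (toConv (AlgHom.id k B)) ≫ φ = specOverMap (c.comap d φ) ≫ c.univ := by
    rw [c.specOverMap_univ]
    exact c.univ_comp d φ
  rw [h2, X.ρ_map_one_tmul, hv] at h1
  have h5 (t : A ⊗[k] X.V) : sliceRight (LinearMap.proj i) (p.baseChange B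
      ((c.comap d φ).toLinearMap.rTensor X.V t)) =
      c.comap d φ (sliceRight (LinearMap.proj i ∘ₗ p) t) := by
    induction t with
    | zero => simp
    | add x y hx hy => simp only [map_add, hx, hy]
    | tmul x y => simp
  refine ⟨sliceRight (LinearMap.proj i ∘ₗ p) (X.ρ A c.univ (1 ⊗ₜ v)), ?_⟩
  rw [← h5, h1]
  simp [Pi.single_apply]

/-- Applying the counit to the regular coaction shows that every element of `B` is a combination of
matrix coefficients. -/
theorem comap_surjective (hφ : ResCoversReps φ) : Function.Surjective (c.comap d φ) := by
  intro a
  obtain ⟨n, b, e, -, ha, hb, he, -⟩ := exists_isComatrix (BialgHom.id k B) a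
  suffices h : Submodule.span k (Set.range b) ≤ LinearMap.range (c.comap d φ).toLinearMap from h ha
  rw [Submodule.span_le]
  rintro _ ⟨j, rfl⟩
  have h1 := congrArg (sliceLeft (counit (R := k) (A := B))) (hb j)
  have h2 : sliceLeft (counit (R := k) (A := B)) (coaction (BialgHom.id k B) (b j)) = b j := by
    have : coaction (BialgHom.id k B) (b j) = comul (R := k) (b j) :=
      LinearMap.congr_fun (LinearMap.lTensor_id B B) _
    rw [this]
    simp [sliceLeft]
  rw [h2] at h1
  rw [h1, map_sum]
  refine Submodule.sum_mem _ fun i _ => ?_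
  rw [sliceLeft_tmul]
  exact Submodule.smul_mem _ _ (c.mem_range_comap_of_isComatrix d hφ he i j)

end Coord

/-! ### Equivariant maps as invariant functionals -/

section Kronecker

variable {m n : Type*} [Fintype m] [Fintype n] [DecidableEq m] [DecidableEq n]

/-- The matrices of the tensor product of a representation with the dual of another. -/
def kroneckerDual {Γ R : Type*} [Group Γ] [CommRing R] (d : Γ →* Matrix n n R)
    (D : Γ →* Matrix m m R) : Γ →* Matrix (n × m) (n × m) R where
  toFun g := Matrix.kroneckerMap (· * ·) (d g) (D g⁻¹).transpose
  map_one' := by simp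
  map_mul' g h := by
    rw [← Matrix.mul_kronecker_mul, ← Matrix.transpose_mul, map_mul, mul_inv_rev, map_mul]

/-- A functional on `X ⊗ W*` is a linear map `F : X → W`, and translating the functional by `g`
turns `F` into `g⁻¹ F g`. -/
theorem sum_mul_kroneckerDual {Γ R : Type*} [Group Γ] [CommRing R] (d : Γ →* Matrix n n R)
    (D : Γ →* Matrix m m R) (F : Matrix m n R) (g : Γ) (j : n) (l : m) :
    ∑ q : n × m, kroneckerDual d D g q (j, l) * F q.2 q.1 = (D g⁻¹ * F * d g) l j := by
  simp only [Fintype.sum_prod_type, kroneckerDual, Matrix.mul_apply, MonoidHom.coe_mk,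
    OneHom.coe_mk, Matrix.kroneckerMap_apply, Matrix.transpose_apply, Finset.sum_mul]
  exact Finset.sum_congr rfl fun i _ => Finset.sum_congr rfl fun i' _ => by ring

end Kronecker

end AffineGroupScheme

namespace AffineGroupScheme

variable {k : Type u} [Field k]

open MonoidalCategory CartesianMonoidalCategory TensorProduct Coalgebra WithConv
  Algebra.TensorProduct

variable {G H : Over (Spec (.of k))} [GrpObj G] [GrpObj H] {A B : Type u} [CommRing A]
  [HopfAlgebra k A] [CommRing B] [HopfAlgebra k B]

section HomRep

variable {m n : Type} [Fintype m] [Fintype n] [DecidableEq m] [DecidableEq n]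
  (d : ∀ (R : Type u) [CommRing R] [Algebra k R], (specOver k R ⟶ G) →* Matrix n n R)
  (D : ∀ (R : Type u) [CommRing R] [Algebra k R], (specOver k R ⟶ G) →* Matrix m m R)

theorem kroneckerDual_map {R S : Type u} [CommRing R] [Algebra k R] [CommRing S] [Algebra k S]
    (hd : ∀ {R S : Type u} [CommRing R] [Algebra k R] [CommRing S] [Algebra k S] (f : R →ₐ[k] S)
        (g : specOver k R ⟶ G), d S (specOverMap f ≫ g) = (d R g).map f)
    (hD : ∀ {R S : Type u} [CommRing R] [Algebra k R] [CommRing S] [Algebra k S] (f : R →ₐ[k] S)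
        (g : specOver k R ⟶ G), D S (specOverMap f ≫ g) = (D R g).map f)
    (f : R →ₐ[k] S) (g : specOver k R ⟶ G) :
    kroneckerDual (d S) (D S) (specOverMap f ≫ g) = (kroneckerDual (d R) (D R) g).map f := by
  ext i j
  have : (specOverMap f ≫ g)⁻¹ = specOverMap f ≫ g⁻¹ := (GrpObj.comp_inv _ _).symm
  simp [kroneckerDual, hd, this, hD]

variable
  (hd : ∀ {R S : Type u} [CommRing R] [Algebra k R] [CommRing S] [Algebra k S] (f : R →ₐ[k] S)
      (g : specOver k R ⟶ G), d S (specOverMap f ≫ g) = (d R g).map f)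
  (hD : ∀ {R S : Type u} [CommRing R] [Algebra k R] [CommRing S] [Algebra k S] (f : R →ₐ[k] S)
      (g : specOver k R ⟶ G), D S (specOverMap f ≫ g) = (D R g).map f)

/-- The tensor product of a representation with the dual of another, in terms of matrices. -/
def FDRep.kroneckerDual : FDRep G :=
  .ofMatrix (Pi.basisFun k (n × m)) (fun R _ _ => AffineGroupScheme.kroneckerDual (d R) (D R))
    (kroneckerDual_map d D hd hD)

/-- The linear functional on `n × m → k` given by a matrix. -/
def matrixFunctional (F : Matrix m n k) : (n × m → k) →ₗ[k] k :=
  (Pi.basisFun k (n × m)).constr k fun q => F q.2 q.1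

/-- The functional given by a matrix is invariant under `g` exactly when the matrix intertwines
the actions of `g`. -/
theorem matrixFunctional_invariant_iff (F : Matrix m n k) {R : Type u} [CommRing R] [Algebra k R]
    (g : specOver k R ⟶ G) :
    (matrixFunctional F).baseChange R ∘ₗ (FDRep.kroneckerDual d D hd hD).ρ R g =
      (matrixFunctional F).baseChange R ↔
    F.map (algebraMap k R) * d R g = D R g * F.map (algebraMap k R) := by
  let r : Module.End R (R ⊗[k] (n × m → k)) := (FDRep.kroneckerDual d D hd hD).ρ R g
  have hr (q : n × m) : r (1 ⊗ₜ Pi.basisFun k (n × m) q) =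
      ∑ i, AffineGroupScheme.kroneckerDual (d R) (D R) g i q ⊗ₜ Pi.basisFun k (n × m) i :=
    FDRep.ofMatrix_ρ_one_tmul _ _ (kroneckerDual_map d D hd hD) R g q
  have hb (q : n × m) : matrixFunctional F (Pi.basisFun k (n × m) q) = F q.2 q.1 :=
    Module.Basis.constr_basis ..
  have hl (q : n × m) : (matrixFunctional F).baseChange R (r (1 ⊗ₜ Pi.basisFun k (n × m) q)) =
      ((D R g⁻¹ * F.map (algebraMap k R) * d R g) q.2 q.1) ⊗ₜ 1 := by
    rw [← sum_mul_kroneckerDual, hr, map_sum, TensorProduct.sum_tmul]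
    refine Finset.sum_congr rfl fun i _ => ?_
    rw [LinearMap.baseChange_tmul, hb, Matrix.map_apply, mul_comm, ← Algebra.smul_def,
      TensorProduct.smul_tmul, smul_eq_mul, mul_one]
  have hrt (q : n × m) : (matrixFunctional F).baseChange R (1 ⊗ₜ Pi.basisFun k (n × m) q) =
      (F.map (algebraMap k R) q.2 q.1) ⊗ₜ 1 := by
    rw [LinearMap.baseChange_tmul, hb, Matrix.map_apply, Algebra.algebraMap_eq_smul_one,
      TensorProduct.smul_tmul, smul_eq_mul, mul_one]
  have key : (matrixFunctional F).baseChange R ∘ₗ r = (matrixFunctional F).baseChange R ↔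
      D R g⁻¹ * F.map (algebraMap k R) * d R g = F.map (algebraMap k R) := by
    constructor
    · intro h
      ext l j
      have := LinearMap.congr_fun h (1 ⊗ₜ Pi.basisFun k (n × m) (j, l))
      rw [LinearMap.comp_apply, hl, hrt] at this
      simpa using congrArg (TensorProduct.rid k R) this
    · intro h
      refine (Algebra.TensorProduct.basis R (Pi.basisFun k (n × m))).ext fun q => ?_
      rw [Algebra.TensorProduct.basis_apply, LinearMap.comp_apply, hl, hrt, h]
  refine key.trans ⟨fun h => ?_, fun h => ?_⟩
  · conv_rhs => rw [← h, ← Matrix.mul_assoc, ← Matrix.mul_assoc, ← map_mul, mul_inv_cancel,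
      map_one, Matrix.one_mul]
  · rw [Matrix.mul_assoc, h, ← Matrix.mul_assoc, ← map_mul, inv_mul_cancel, map_one,
      Matrix.one_mul]

end HomRep

namespace Coord

variable (c : Coord G A) (d : Coord H B) {φ : H ⟶ G} [IsMonHom φ]

theorem comapBialgHom_apply (a : A) : c.comapBialgHom d φ a = c.comap d φ a := rfl

theorem coaction_comapBialgHom (a : A) : coaction (c.comapBialgHom d φ) a =
    (c.comap d φ).toLinearMap.lTensor A (comul a) := rfl

/-- An element of `A` vanishing on `H` lies in the image of an `H`-equivariant map from a
representation of `G` to the functions on `G` vanishing on `H`. -/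
theorem exists_equivariant_map (hφ : ResCoversReps φ) (a : A) (ha : c.comap d φ a = 0) :
    ∃ (X : FDRep G) (f : X.V →ₗ[k] A), a ∈ LinearMap.range f ∧ (∀ v, c.comap d φ (f v) = 0) ∧
      (∀ v, coaction (c.comapBialgHom d φ) (f v) =
        TensorProduct.comm k B A (f.lTensor B (X.ρ B (d.univ ≫ φ) (1 ⊗ₜ v)))) ∧
      LinearMap.range f ≤ Submodule.span k (Set.range fun ξ : B →ₗ[k] k =>
        sliceRight ξ (coaction (c.comapBialgHom d φ) a)) := by
  obtain ⟨n, b, e, -, hab, hb, he, hs⟩ := exists_isComatrix (c.comapBialgHom d φ) a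
  obtain ⟨X, p, hp, h⟩ := d.exists_cover_of_isComatrix hφ he
  let U : (Fin n → k) →ₗ[k] A := Fintype.linearCombination k b
  have hU (l : Fin n) : U (Pi.basisFun k _ l) = b l := by simp [U]
  have hUs (w : Fin n → k) : U w = ∑ l, w l • b l := Fintype.linearCombination_apply ..
  -- Each `b l` is a slice of the coaction of `a`, so its image in `B` is a slice of `comul` of the
  -- image of `a`, which is zero.
  have hb0 (l : Fin n) : c.comap d φ (b l) = 0 := by
    obtain ⟨ξ, hξ⟩ := hs l
    have h1 (t : A ⊗[k] A) : c.comap d φ (sliceRight ξ ((c.comap d φ).toLinearMap.lTensor A t)) =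
        sliceRight ξ (TensorProduct.map (c.comap d φ).toLinearMap (c.comap d φ).toLinearMap t) := by
      induction t with
      | zero => simp
      | add x y hx hy => simp only [map_add, hx, hy]
      | tmul x y => simp
    have h2 : TensorProduct.map (c.comap d φ).toLinearMap (c.comap d φ).toLinearMap (comul a) =
        comul (R := k) (c.comap d φ a) :=
      CoalgHomClass.map_comp_comul_apply (c.comapBialgHom d φ) a
    rw [hξ, coaction_comapBialgHom, h1, h2, ha, map_zero, map_zero]
  refine ⟨X, U ∘ₗ p, ?_, fun v => ?_, fun v => ?_, ?_⟩
  · rw [LinearMap.range_comp, LinearMap.range_eq_top.2 hp, Submodule.map_top,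
      Fintype.range_linearCombination]
    exact hab
  · simp [hUs, hb0]
  · have h1 := congrArg (U.lTensor B) (h B (toConv (AlgHom.id k B)) v)
    have h2 (t : B ⊗[k] X.V) : U.lTensor B (p.baseChange B t) = (U ∘ₗ p).lTensor B t :=
      (LinearMap.lTensor_comp_apply ..).symm
    rw [h2] at h1
    change _ = TensorProduct.comm k B A ((U ∘ₗ p).lTensor B
      (X.ρ B (d.pt B (toConv (AlgHom.id k B)) ≫ φ) (1 ⊗ₜ v)))
    rw [h1, LinearMap.comp_apply, hUs]
    simp only [map_sum, map_smul, hb, LinearMap.lTensor_tmul, hU, TensorProduct.comm_tmul]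
    rfl
  · rintro _ ⟨v, rfl⟩
    rw [LinearMap.comp_apply, hUs]
    refine Submodule.sum_mem _ fun l _ => Submodule.smul_mem _ _ (Submodule.subset_span ?_)
    obtain ⟨ξ, hξ⟩ := hs l
    exact ⟨ξ, hξ.symm⟩

end Coord

end AffineGroupScheme

/-! ### Invariant functionals detect the equations of `H` -/

namespace AffineGroupScheme

variable {k : Type u} [Field k]

open MonoidalCategory CartesianMonoidalCategory TensorProduct Coalgebra WithConv
  Algebra.TensorProduct

variable {G H : Over (Spec (.of k))} [GrpObj G] [GrpObj H] {A B : Type u} [CommRing A]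
  [HopfAlgebra k A] [CommRing B] [HopfAlgebra k B]

namespace Coord

variable (c : Coord G A) (d : Coord H B) {φ : H ⟶ G} [IsMonHom φ]

/-- A point of `G` leaving invariant all `H`-invariant functionals on representations of `G`
satisfies the equations defining `H`. -/
theorem eq_zero_of_invariant (hφ : ResCoversReps φ) {R : Type u} [CommRing R] [Algebra k R]
    (x : WithConv (A →ₐ[k] R))
    (hx : ∀ (X : FDRep G) (l : X.V →ₗ[k] k),
      (∀ (S : Type u) [CommRing S] [Algebra k S] (h : specOver k S ⟶ H),
        l.baseChange S ∘ₗ X.ρ S (h ≫ φ) = l.baseChange S) →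
      l.baseChange R ∘ₗ X.ρ R (c.pt R x) = l.baseChange R)
    (a : A) (ha : c.comap d φ a = 0) : x.ofConv a = 0 := by
  obtain ⟨X, f, haf, hf0, hfe, hfs⟩ := c.exists_equivariant_map d hφ a ha
  -- The span `W` of `w` is a subspace of the right regular representation that is stable under `G`,
  -- not only under `H`, so `f : X → W` is an `H`-equivariant map between representations of `G`.
  obtain ⟨m, w, D, hLI, haw, hw, hD, -⟩ := exists_isComatrix (BialgHom.id k A) a
  have hw' (j : Fin m) : comul (R := k) (w j) = ∑ i, w i ⊗ₜ D i j := by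
    rw [← hw]
    exact (LinearMap.congr_fun (LinearMap.lTensor_id A A) _).symm
  have hwψ (j : Fin m) : coaction (c.comapBialgHom d φ) (w j) =
      ∑ i, w i ⊗ₜ c.comap d φ (D i j) := by
    rw [coaction_comapBialgHom, hw']
    simp
  have hfw (v : X.V) : f v ∈ Submodule.span k (Set.range w) := by
    refine (hfs.trans (Submodule.span_le.2 ?_)) ⟨v, rfl⟩
    rintro _ ⟨ξ, rfl⟩
    change sliceRight ξ (coaction (c.comapBialgHom d φ) a) ∈ _
    clear hfs haf ha
    induction haw using Submodule.span_induction with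
    | zero => simp
    | add x y _ _ hx hy =>
      rw [map_add, map_add]
      exact add_mem hx hy
    | smul r x _ hx =>
      rw [map_smul, map_smul]
      exact Submodule.smul_mem _ _ hx
    | mem x hx =>
      obtain ⟨j, rfl⟩ := hx
      rw [hwψ, map_sum]
      refine Submodule.sum_mem _ fun i _ => ?_
      rw [sliceRight_tmul]
      exact Submodule.smul_mem _ _ (Submodule.subset_span ⟨i, rfl⟩)
  let β := Module.finBasis k X.V
  choose F' hF' using fun j => (Submodule.mem_span_range_iff_exists_fun k).1 (hfw (β j))
  let F : Matrix (Fin m) (Fin _) k := Matrix.of fun l j => F' j l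
  have hF (j) : f (β j) = ∑ l, F l j • w l := (hF' j).symm
  obtain ⟨r, hr⟩ := (Fintype.linearCombination k w).exists_leftInverse_of_injective
    (LinearMap.ker_eq_bot.2
      (linearIndependent_iff_injective_fintypeLinearCombination.1 hLI))
  have hrw (i j : Fin m) : r (w j) i = (1 : Matrix (Fin m) (Fin m) k) i j := by
    have := LinearMap.congr_fun hr (Pi.single j 1)
    rw [LinearMap.comp_apply, Fintype.linearCombination_apply_single, one_smul] at this
    rw [this, LinearMap.id_apply, Matrix.one_apply, Pi.single_apply]
  -- Equivariance of `f` in coordinates, at the universal point of `H`; `hS` specializes it to all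
  -- points.
  have hB : F.map (algebraMap k B) * X.matrix β B (d.univ ≫ φ) =
      D.map (c.comap d φ) * F.map (algebraMap k B) := by
    ext i j
    have h1 := hfe (β j)
    rw [X.ρ_one_tmul_basis, hF] at h1
    simp only [map_sum, map_smul, hwψ, LinearMap.lTensor_tmul, TensorProduct.comm_tmul, hF,
      TensorProduct.sum_tmul] at h1
    have h2 := congrArg (sliceLeft (LinearMap.proj i ∘ₗ r)) h1
    simp only [map_sum, map_smul, sliceLeft_tmul, LinearMap.comp_apply, LinearMap.proj_apply, hrw,
      Matrix.one_apply, ite_smul, one_smul, zero_smul, ← TensorProduct.smul_tmul', smul_ite,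
      smul_zero, Finset.sum_ite_eq, Finset.mem_univ, if_true] at h2
    simp only [Matrix.mul_apply, Matrix.map_apply, ← Algebra.smul_def]
    rw [← h2]
    exact Finset.sum_congr rfl fun l _ => by rw [mul_comm, Algebra.smul_def]
  have hS (S : Type u) [CommRing S] [Algebra k S] (h : specOver k S ⟶ H) :
      F.map (algebraMap k S) * X.matrix β S (h ≫ φ) =
        (hD.eval S).comp ((c.pt S).symm : _ →* _) (h ≫ φ) * F.map (algebraMap k S) := by
    obtain ⟨y, rfl⟩ := (d.pt S).surjective h
    have h1 : d.pt S y ≫ φ = specOverMap y.ofConv ≫ d.univ ≫ φ := by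
      rw [← Category.assoc, d.specOverMap_univ, toConv_ofConv]
    have h2 : F.map (algebraMap k S) = (F.map (algebraMap k B)).map y.ofConv := by
      ext
      simp
    have h3 : (hD.eval B).comp ((c.pt B).symm : _ →* _) (d.univ ≫ φ) = D.map (c.comap d φ) := rfl
    rw [h1, X.matrix_map, c.eval_pt_symm_comp hD, h3, h2, ← Matrix.map_mul, hB, Matrix.map_mul]
  have hR := (matrixFunctional_invariant_iff (fun R _ _ => X.matrix β R)
    (fun R _ _ => (hD.eval R).comp ((c.pt R).symm : _ →* _)) (X.matrix_map β)
    (c.eval_pt_symm_comp hD) F (c.pt R x)).1 (hx _ _ fun S _ _ h =>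
      (matrixFunctional_invariant_iff ..).2 (hS S h))
  have hR' : F.map (algebraMap k R) * X.matrix β R (c.pt R x) =
      D.map x.ofConv * F.map (algebraMap k R) := by
    rw [hR]
    simp
  -- The identity of `G` lies in `H`, so the counit vanishes on the ideal of `H`.
  have hε (v : X.V) : counit (R := k) (f v) = 0 := by
    have : counit (R := k) (c.comapBialgHom d φ (f v)) = counit (R := k) (f v) :=
      CoalgHomClass.counit_comp_apply _ _
    rw [← this, comapBialgHom_apply, hf0, map_zero]
  have hwx (l : Fin m) : x.ofConv (w l) = ∑ i, counit (R := k) (w i) • x.ofConv (D i l) := by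
    have h1 := Coalgebra.rTensor_counit_comul (R := k) (w l)
    rw [hw'] at h1
    have h2 := congrArg (TensorProduct.lid k A) h1
    simp only [map_sum, LinearMap.rTensor_tmul, TensorProduct.lid_tmul, one_smul] at h2
    rw [← h2]
    simp
  -- Evaluation at `x` is translation by `x` followed by the counit. As `x` commutes with `f`, the
  -- value at `f v` is the counit applied to `f (x · v)`, which is zero.
  have hxf : x.ofConv.toLinearMap ∘ₗ f = 0 := by
    refine β.ext fun j => ?_
    calc x.ofConv (f (β j)) = ∑ l, ∑ i, F l j • counit (R := k) (w i) • x.ofConv (D i l) := by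
          simp [hF, hwx, Finset.smul_sum]
      _ = ∑ i, counit (R := k) (w i) • (D.map x.ofConv * F.map (algebraMap k R)) i j := by
          rw [Finset.sum_comm]
          simp only [Matrix.mul_apply, Matrix.map_apply, Finset.smul_sum]
          refine Finset.sum_congr rfl fun i _ => Finset.sum_congr rfl fun l _ => ?_
          rw [smul_comm, mul_comm, Algebra.smul_def (F l j)]
      _ = ∑ l, counit (R := k) (f (β l)) • X.matrix β R (c.pt R x) l j := by
          rw [← hR']
          simp only [Matrix.mul_apply, Matrix.map_apply, Finset.smul_sum, hF, map_sum, map_smul,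
            Finset.sum_smul]
          rw [Finset.sum_comm]
          refine Finset.sum_congr rfl fun i _ => Finset.sum_congr rfl fun l _ => ?_
          rw [← Algebra.smul_def, smul_smul, smul_eq_mul, mul_comm]
      _ = 0 := by simp [hε]
  obtain ⟨v, rfl⟩ := haf
  exact LinearMap.congr_fun hxf v

end Coord

end AffineGroupScheme

/-! ### `H` as the kernel of the action on `ind 𝟙`; normality -/

namespace AffineGroupScheme

variable {k : Type u} [Field k]

open MonoidalCategory CartesianMonoidalCategory TensorProduct Coalgebra WithConv
  Algebra.TensorProduct

variable {G H : Over (Spec (.of k))} [GrpObj G] [GrpObj H] {A B : Type u} [CommRing A]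
  [HopfAlgebra k A] [CommRing B] [HopfAlgebra k B]

/-- An `H`-invariant functional on a representation of `G` is invariant under the points of `G`
acting trivially on the representation coinduced from the unit. -/
theorem invariant_of_adjunction {φ : H ⟶ G} [IsMonHom φ] {ind : FDRep H ⥤ FDRep G}
    (adj : FDRep.res φ ⊣ ind) {R : Type u} [CommRing R] [Algebra k R] (g : specOver k R ⟶ G)
    (hg : (ind.obj (FDRep.unit H)).ρ R g = 1) (X : FDRep G) (l : X.V →ₗ[k] k)
    (hl : ∀ (S : Type u) [CommRing S] [Algebra k S] (h : specOver k S ⟶ H),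
      l.baseChange S ∘ₗ X.ρ S (h ≫ φ) = l.baseChange S) :
    l.baseChange R ∘ₗ X.ρ R g = l.baseChange R := by
  let l' : (FDRep.res φ).obj X ⟶ FDRep.unit H :=
    ⟨l, fun S _ _ h x => LinearMap.congr_fun (hl S h) x⟩
  let f := adj.homEquiv X (FDRep.unit H) l'
  let ε : (ind.obj (FDRep.unit H)).V →ₗ[k] k := (adj.counit.app (FDRep.unit H)).toLinearMap
  have h1 : (FDRep.res φ).map f ≫ adj.counit.app (FDRep.unit H) = l' :=
    (adj.homEquiv_counit ..).symm.trans (Equiv.symm_apply_apply _ _)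
  have h2 : l = ε ∘ₗ f.toLinearMap := congrArg FDRep.Hom.toLinearMap h1.symm
  refine LinearMap.ext fun v => ?_
  rw [h2, LinearMap.baseChange_comp, LinearMap.comp_apply, LinearMap.comp_apply,
    LinearMap.comp_apply, f.comm, hg]
  rfl

namespace Coord

variable {φ : H ⟶ G} [IsMonHom φ]

/-- Such a point preserves all `H`-invariant functionals, hence kills the kernel of the surjection
`A → B` and factors through `B`. -/
theorem exists_comp_eq_of_ρ_eq_one (c : Coord G A) (d : Coord H B) {ind : FDRep H ⥤ FDRep G}
    (adj : FDRep.res φ ⊣ ind) [ind.Faithful] {R : Type u} [CommRing R] [Algebra k R]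
    (g : specOver k R ⟶ G)
    (hg : (ind.obj (FDRep.unit H)).ρ R g = 1) : ∃ h, h ≫ φ = g := by
  obtain ⟨x, rfl⟩ := (c.pt R).surjective g
  have hφ := resCoversReps_of_adjunction φ adj
  have h0 := c.eq_zero_of_invariant d hφ x (invariant_of_adjunction adj _ hg)
  let y := (c.comap d φ).liftOfSurjective (c.comap_surjective d hφ) x.ofConv h0
  refine ⟨d.pt R (toConv y), ?_⟩
  rw [c.pt_comp_hom d]
  exact congrArg (fun z => c.pt R (toConv z)) (AlgHom.liftOfSurjective_comp ..)

theorem normal_of_adjunction (c : Coord G A) (d : Coord H B) {ind : FDRep H ⥤ FDRep G}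
    (adj : FDRep.res φ ⊣ ind) [ind.Faithful]
    (htriv : ((FDRep.res φ).obj (ind.obj (FDRep.unit H))).IsTrivial) :
    IsMonHom.Normal φ := by
  have hφ := resCoversReps_of_adjunction φ adj
  have : IsClosedImmersion φ.left := c.isClosedImmersion d φ (c.comap_surjective d hφ)
  have : Mono φ := Over.mono_of_mono_left φ
  have : IsAffine G.left := c.isAffine
  have : IsAffine H.left := d.isAffine
  have : IsAffine (G ⊗ H).left := inferInstanceAs (IsAffine (pullback G.hom H.hom))
  obtain ⟨R, _, _, ⟨e⟩⟩ := exists_specOver_iso (G ⊗ H)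
  rw [IsMonHom.isNormalHom_iff]
  -- The universal conjugate `g φ(h) g⁻¹`, a point over `G ⊗ H`, acts trivially on `ind 𝟙` because
  -- `φ(h)` does.
  obtain ⟨h, hh⟩ := c.exists_comp_eq_of_ρ_eq_one d adj (e.hom ≫ G ◁ φ ≫ GrpObj.conj G) (by
    have h1 : e.hom ≫ G ◁ φ ≫ GrpObj.conj G = (e.hom ≫ fst G H) * ((e.hom ≫ snd G H) ≫ φ) *
        (e.hom ≫ fst G H)⁻¹ := by
      simp [GrpObj.conj, MonObj.comp_mul, GrpObj.comp_inv]
    have h2 : (ind.obj (FDRep.unit H)).ρ R ((e.hom ≫ snd G H) ≫ φ) = 1 := htriv R _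
    rw [h1, map_mul, map_mul, h2, mul_one, ← map_mul, mul_inv_cancel, map_one])
  exact ⟨e.inv ≫ h, by rw [Category.assoc, hh, e.inv_hom_id_assoc]⟩

end Coord

end AffineGroupScheme

/-! ### The Hopf algebra of invariant functions -/

namespace AffineGroupScheme

variable {k : Type u} [Field k]

open TensorProduct Coalgebra WithConv Algebra.TensorProduct

section Descent

variable {A C : Type u} [CommRing A] [HopfAlgebra k A] [CommRing C] [Algebra k C]

theorem convMul_antipode : (toConv (AlgHom.id k A) * toConv (HopfAlgebra.antipodeAlgHom k A) :
    WithConv (A →ₐ[k] A)) = 1 :=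
  mul_inv_cancel (toConv (AlgHom.id k A))

/-- The group of points of a commutative Hopf algebra. -/
abbrev pointGroup (A R : Type*) [CommRing A] [HopfAlgebra k A] [CommRing R] [Algebra k R] :
    Group (WithConv (A →ₐ[k] R)) where
  inv x := toConv (x.ofConv.comp (HopfAlgebra.antipodeAlgHom k A))
  inv_mul_cancel x := by
    have h := congrArg (fun z : WithConv (A →ₐ[k] A) => toConv (x.ofConv.comp z.ofConv))
      (AlgHom.antipode_id_cancel (R := k) (A := A))
    refine Eq.trans ?_ (h.trans ?_)
    · exact (congrArg toConv (AlgHom.comp_convMul_distrib x.ofConv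
        (toConv (HopfAlgebra.antipodeAlgHom k A)) (toConv (AlgHom.id k A)))).symm
    · exact congrArg toConv (AlgHom.ext fun a => x.ofConv.commutes _)

/-- A subalgebra stable under comultiplication and antipode is a Hopf algebra. -/
theorem exists_hopfAlgebra_of_injective (i : C →ₐ[k] A) (hi : Function.Injective i)
    (Δ : C →ₐ[k] C ⊗[k] C)
    (hΔ : (Algebra.TensorProduct.map i i).comp Δ = (Bialgebra.comulAlgHom k A).comp i)
    (S : C →ₐ[k] C) (hS : i.comp S = (HopfAlgebra.antipodeAlgHom k A).comp i) :
    ∃ (C' : Type u) (_ : CommRing C') (_ : HopfAlgebra k C') (j : C' →ₐc[k] A),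
      Function.Injective j ∧ ∀ a, (∃ x, j x = a) ↔ ∃ x, i x = a := by
  -- Tensor powers of `i` stay injective over a field, so each Hopf algebra axiom for `C` can be
  -- checked in `A`.
  have h2 : Function.Injective (Algebra.TensorProduct.map i i) :=
    TensorProduct.map_injective_of_flat_flat i.toLinearMap i.toLinearMap hi hi
  have h3 : Function.Injective (Algebra.TensorProduct.map i (Algebra.TensorProduct.map i i)) :=
    TensorProduct.map_injective_of_flat_flat i.toLinearMap
      (Algebra.TensorProduct.map i i).toLinearMap hi h2
  let ε : C →ₐ[k] k := (Bialgebra.counitAlgHom k A).comp i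
  let _ : Bialgebra k C := .ofAlgHom Δ ε
    (by
      refine (AlgHom.cancel_left h3).1 ?_
      have e1 : (Algebra.TensorProduct.map i (Algebra.TensorProduct.map i i)).comp
          (Algebra.TensorProduct.assoc k k k C C C : (C ⊗[k] C) ⊗[k] C →ₐ[k] C ⊗[k] (C ⊗[k] C)) =
          (Algebra.TensorProduct.assoc k k k A A A :
            (A ⊗[k] A) ⊗[k] A →ₐ[k] A ⊗[k] (A ⊗[k] A)).comp
            (Algebra.TensorProduct.map (Algebra.TensorProduct.map i i) i) := by
        ext <;> simp [Algebra.TensorProduct.one_def]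
      have e2 : (Algebra.TensorProduct.map (Algebra.TensorProduct.map i i) i).comp
          (Algebra.TensorProduct.map Δ (AlgHom.id k C)) =
          (Algebra.TensorProduct.map (Bialgebra.comulAlgHom k A) (AlgHom.id k A)).comp
            (Algebra.TensorProduct.map i i) := by
        rw [← Algebra.TensorProduct.map_comp, ← Algebra.TensorProduct.map_comp, hΔ]
        rfl
      have e3 : (Algebra.TensorProduct.map i (Algebra.TensorProduct.map i i)).comp
          (Algebra.TensorProduct.map (AlgHom.id k C) Δ) =
          (Algebra.TensorProduct.map (AlgHom.id k A) (Bialgebra.comulAlgHom k A)).comp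
            (Algebra.TensorProduct.map i i) := by
        rw [← Algebra.TensorProduct.map_comp, ← Algebra.TensorProduct.map_comp, hΔ]
        rfl
      let αC : (C ⊗[k] C) ⊗[k] C →ₐ[k] C ⊗[k] (C ⊗[k] C) :=
        (Algebra.TensorProduct.assoc k k k C C C).toAlgHom
      let αA : (A ⊗[k] A) ⊗[k] A →ₐ[k] A ⊗[k] (A ⊗[k] A) :=
        (Algebra.TensorProduct.assoc k k k A A A).toAlgHom
      calc (Algebra.TensorProduct.map i (Algebra.TensorProduct.map i i)).comp
            (αC.comp ((Algebra.TensorProduct.map Δ (AlgHom.id k C)).comp Δ))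
          = αA.comp (((Algebra.TensorProduct.map (Algebra.TensorProduct.map i i) i).comp
            (Algebra.TensorProduct.map Δ (AlgHom.id k C))).comp Δ) :=
            congrArg (fun f => f.comp ((Algebra.TensorProduct.map Δ (AlgHom.id k C)).comp Δ)) e1
        _ = αA.comp ((Algebra.TensorProduct.map (Bialgebra.comulAlgHom k A) (AlgHom.id k A)).comp
            ((Algebra.TensorProduct.map i i).comp Δ)) := by rw [e2]; rfl
        _ = (Algebra.TensorProduct.map (AlgHom.id k A) (Bialgebra.comulAlgHom k A)).comp
            ((Algebra.TensorProduct.map i i).comp Δ) := by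
            rw [hΔ]
            exact AlgHom.ext fun x => Coalgebra.coassoc_apply (i x)
        _ = ((Algebra.TensorProduct.map i (Algebra.TensorProduct.map i i)).comp
            (Algebra.TensorProduct.map (AlgHom.id k C) Δ)).comp Δ := by rw [e3]; rfl)
    (by
      have inj' : Function.Injective (Algebra.TensorProduct.map (AlgHom.id k k) i) :=
        TensorProduct.map_injective_of_flat_flat LinearMap.id i.toLinearMap Function.injective_id hi
      refine (AlgHom.cancel_left inj').1 ?_
      rw [← AlgHom.comp_assoc, ← Algebra.TensorProduct.map_comp]
      have e1 : Algebra.TensorProduct.map ((AlgHom.id k k).comp ε) (i.comp (AlgHom.id k C)) =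
          (Algebra.TensorProduct.map (Bialgebra.counitAlgHom k A) (AlgHom.id k A)).comp
            (Algebra.TensorProduct.map i i) := by
        rw [← Algebra.TensorProduct.map_comp]
        rfl
      rw [e1, AlgHom.comp_assoc, hΔ]
      ext c
      exact Coalgebra.rTensor_counit_comul (i c))
    (by
      have inj' : Function.Injective (Algebra.TensorProduct.map i (AlgHom.id k k)) :=
        TensorProduct.map_injective_of_flat_flat i.toLinearMap LinearMap.id hi Function.injective_id
      refine (AlgHom.cancel_left inj').1 ?_
      rw [← AlgHom.comp_assoc, ← Algebra.TensorProduct.map_comp]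
      have e1 : Algebra.TensorProduct.map (i.comp (AlgHom.id k C)) ((AlgHom.id k k).comp ε) =
          (Algebra.TensorProduct.map (AlgHom.id k A) (Bialgebra.counitAlgHom k A)).comp
            (Algebra.TensorProduct.map i i) := by
        rw [← Algebra.TensorProduct.map_comp]
        rfl
      rw [e1, AlgHom.comp_assoc, hΔ]
      ext c
      exact Coalgebra.lTensor_counit_comul (i c))
  have hl : (Algebra.TensorProduct.lift S (AlgHom.id k C) fun _ _ => .all ..).comp Δ =
      (Algebra.ofId k C).comp ε := by
    refine (AlgHom.cancel_left hi).1 ?_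
    have e1 : i.comp (Algebra.TensorProduct.lift S (AlgHom.id k C) fun _ _ => .all ..) =
        (Algebra.TensorProduct.lift (HopfAlgebra.antipodeAlgHom k A) (AlgHom.id k A)
          fun _ _ => .all ..).comp (Algebra.TensorProduct.map i i) := by
      ext c
      · simpa using AlgHom.congr_fun hS c
      · simp
    rw [← AlgHom.comp_assoc, e1, AlgHom.comp_assoc, hΔ]
    ext c
    refine (AlgHom.convMul_apply (toConv (HopfAlgebra.antipodeAlgHom k A))
      (toConv (AlgHom.id k A)) (i c)).symm.trans ?_
    rw [AlgHom.antipode_id_cancel]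
    exact (i.commutes _).symm
  have hr : (Algebra.TensorProduct.lift (AlgHom.id k C) S fun _ _ => .all ..).comp Δ =
      (Algebra.ofId k C).comp ε := by
    refine (AlgHom.cancel_left hi).1 ?_
    have e1 : i.comp (Algebra.TensorProduct.lift (AlgHom.id k C) S fun _ _ => .all ..) =
        (Algebra.TensorProduct.lift (AlgHom.id k A) (HopfAlgebra.antipodeAlgHom k A)
          fun _ _ => .all ..).comp (Algebra.TensorProduct.map i i) := by
      ext c
      · simp
      · simpa using AlgHom.congr_fun hS c
    rw [← AlgHom.comp_assoc, e1, AlgHom.comp_assoc, hΔ]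
    ext c
    refine (AlgHom.convMul_apply (toConv (AlgHom.id k A))
      (toConv (HopfAlgebra.antipodeAlgHom k A)) (i c)).symm.trans ?_
    rw [convMul_antipode]
    exact (i.commutes _).symm
  exact ⟨C, inferInstance, .ofAlgHom S hl hr, .ofAlgHom i rfl hΔ, hi, fun _ => Iff.rfl⟩

end Descent

section Invariants

variable {A B : Type u} [CommRing A] [HopfAlgebra k A] [CommRing B] [HopfAlgebra k B]
  (ψ : A →ₐc[k] B)

/-- Composition of points with a bialgebra homomorphism is a group homomorphism. -/
def convComp (R : Type u) [CommRing R] [Algebra k R] :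
    WithConv (B →ₐ[k] R) →* WithConv (A →ₐ[k] R) where
  toFun h := toConv (h.ofConv.comp (ψ : A →ₐ[k] B))
  map_one' := by
    refine congrArg toConv (AlgHom.ext fun a => ?_)
    change algebraMap k R (counit (R := k) (ψ a)) = algebraMap k R (counit a)
    rw [CoalgHomClass.counit_comp_apply]
  map_mul' x y := congrArg toConv (AlgHom.convMul_comp_bialgHom_distrib x y ψ)

theorem comp_convComp {R S : Type u} [CommRing R] [Algebra k R] [CommRing S] [Algebra k S]
    (f : R →ₐ[k] S) (h : WithConv (B →ₐ[k] R)) :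
    toConv (f.comp (convComp ψ R h).ofConv) = convComp ψ S (toConv (f.comp h.ofConv)) := rfl

/-- The functions `a` on a group satisfying `a(x h y) = a(x y)` for all points `h` of a
subgroup. -/
def invariants : Subalgebra k A where
  carrier := {a | ∀ (R : Type u) [CommRing R] [Algebra k R] (x y : WithConv (A →ₐ[k] R))
    (h : WithConv (B →ₐ[k] R)), (x * convComp ψ R h * y).ofConv a = (x * y).ofConv a}
  mul_mem' ha hb R _ _ x y h := by rw [map_mul, map_mul, ha, hb]
  add_mem' ha hb R _ _ x y h := by rw [map_add, map_add, ha, hb]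
  algebraMap_mem' r R _ _ x y h := by rw [AlgHom.commutes, AlgHom.commutes]

theorem map_comul_apply {R S : Type*} [CommRing R] [Algebra k R] [CommRing S] [Algebra k S]
    (x : A →ₐ[k] R) (y : A →ₐ[k] S) (a : A) :
    Algebra.TensorProduct.map x y (comul a) =
      (toConv (includeLeft.comp x) * toConv (includeRight.comp y) :
        WithConv (A →ₐ[k] R ⊗[k] S)).ofConv a := by
  change _ = (toConv (includeLeft.comp x) * toConv (includeRight.comp y) :
        WithConv (A →ₐ[k] R ⊗[k] S)) a
  rw [AlgHom.convMul_apply]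
  generalize comul (R := k) a = t
  induction t with
  | zero => simp
  | add x y hx hy => simp only [map_add, hx, hy]
  | tmul x y => simp

theorem map_sliceRight {R : Type*} [CommRing R] [Algebra k R] (x : A →ₐ[k] R) (ξ : A →ₗ[k] k)
    (t : A ⊗[k] A) : x (sliceRight ξ t) =
      sliceRight ξ (Algebra.TensorProduct.map x (AlgHom.id k A) t) := by
  induction t with
  | zero => simp
  | add x y hx hy => simp only [map_add, hx, hy]
  | tmul x y => simp

theorem map_sliceLeft {R : Type*} [CommRing R] [Algebra k R] (x : A →ₐ[k] R) (ξ : A →ₗ[k] k)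
    (t : A ⊗[k] A) : x (sliceLeft ξ t) =
      sliceLeft ξ (Algebra.TensorProduct.map (AlgHom.id k A) x t) := by
  induction t with
  | zero => simp
  | add x y hx hy => simp only [map_add, hx, hy]
  | tmul x y => simp

/-- The condition on the slice over `R` follows from the condition on `a` over `R ⊗ A`, with `y`
multiplied on the right by the universal point. The two-sided form of invariance makes the left
slice work likewise, with the universal point to the left of `x`. -/
theorem sliceRight_comul_mem_invariants {a : A} (ha : a ∈ invariants ψ) (ξ : A →ₗ[k] k) :
    sliceRight ξ (comul a) ∈ invariants ψ := by
  intro R _ _ x y h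
  rw [map_sliceRight, map_sliceRight, map_comul_apply, map_comul_apply, comp_convMul, comp_convMul,
    comp_convMul, comp_convComp, mul_assoc _ _ (toConv (includeRight.comp _)), ha, ← mul_assoc]

theorem sliceLeft_comul_mem_invariants {a : A} (ha : a ∈ invariants ψ) (ξ : A →ₗ[k] k) :
    sliceLeft ξ (comul a) ∈ invariants ψ := by
  intro R _ _ x y h
  rw [map_sliceLeft, map_sliceLeft, map_comul_apply, map_comul_apply, comp_convMul, comp_convMul,
    comp_convMul, comp_convComp, ← mul_assoc, ← mul_assoc, ha, mul_assoc]

/-- The inverse of `x h y` is `y⁻¹ h⁻¹ x⁻¹`, again of the same shape. -/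
theorem antipode_mem_invariants {a : A} (ha : a ∈ invariants ψ) :
    HopfAlgebra.antipode k a ∈ invariants ψ := by
  intro R _ _ x y h
  let _ : Group (WithConv (A →ₐ[k] R)) := pointGroup A R
  let _ : Group (WithConv (B →ₐ[k] R)) := pointGroup B R
  have key (z : WithConv (A →ₐ[k] R)) : z.ofConv (HopfAlgebra.antipode k a) = z⁻¹.ofConv a := rfl
  rw [key, key, mul_inv_rev, mul_inv_rev, mul_inv_rev, ← map_inv, ← mul_assoc, ha]

/-- The functions invariant under a subgroup form a Hopf algebra. -/
theorem exists_hopfAlgebra_invariants :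
    ∃ (C : Type u) (_ : CommRing C) (_ : HopfAlgebra k C) (j : C →ₐc[k] A),
      Function.Injective j ∧ ∀ a, a ∈ invariants ψ ↔ ∃ x, j x = a := by
  let i := (invariants ψ).val
  have hi : Function.Injective i := Subtype.val_injective
  have h2 : Function.Injective (Algebra.TensorProduct.map i i) :=
    TensorProduct.map_injective_of_flat_flat i.toLinearMap i.toLinearMap hi hi
  -- A tensor with all left and right slices in a subspace lies in its tensor square, so `comul`
  -- restricts to the invariants.
  have hmem (a : invariants ψ) : (Bialgebra.comulAlgHom k A).comp i a ∈
      (Algebra.TensorProduct.map i i).range :=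
    mem_range_map_subtype (Subalgebra.toSubmodule (invariants ψ)) (comul (a : A))
      (sliceRight_comul_mem_invariants ψ a.2) (sliceLeft_comul_mem_invariants ψ a.2)
  let Δ := (AlgEquiv.ofInjective _ h2).symm.toAlgHom.comp
    (((Bialgebra.comulAlgHom k A).comp i).codRestrict _ hmem)
  let S := ((HopfAlgebra.antipodeAlgHom k A).comp i).codRestrict (invariants ψ) fun a =>
    antipode_mem_invariants ψ a.2
  obtain ⟨C, _, _, j, hj, h⟩ := exists_hopfAlgebra_of_injective i hi Δ (by
    ext a
    exact congrArg Subtype.val ((AlgEquiv.ofInjective _ h2).apply_symm_apply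
      (((Bialgebra.comulAlgHom k A).comp i).codRestrict _ hmem a))) S rfl
  exact ⟨C, _, _, j, hj, fun a => ⟨fun ha => (h a).2 ⟨⟨a, ha⟩, rfl⟩, fun ha => by
    obtain ⟨x, rfl⟩ := (h a).1 ha
    exact x.2⟩⟩

end Invariants

end AffineGroupScheme

/-! ### The cokernel -/

namespace AffineGroupScheme

variable {k : Type u} [Field k]

open MonoidalCategory CartesianMonoidalCategory TensorProduct Coalgebra WithConv
  Algebra.TensorProduct

variable {G H Q : Over (Spec (.of k))} [GrpObj G] [GrpObj H] [GrpObj Q] {A B C : Type u}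
  [CommRing A] [HopfAlgebra k A] [CommRing B] [HopfAlgebra k B] [CommRing C] [HopfAlgebra k C]

/-- A bialgebra homomorphism with values in the image of an injective one factors through it. -/
theorem exists_bialgHom_lift {D : Type u} [CommRing D] [HopfAlgebra k D] (j : C →ₐc[k] A)
    (hj : Function.Injective j) (θ : D →ₐc[k] A) (h : ∀ x, ∃ y, j y = θ x) :
    ∃ θ' : D →ₐc[k] C, ∀ x, j (θ' x) = θ x := by
  let i : C →ₐ[k] A := j
  let e := AlgEquiv.ofInjective i hj
  let t : D →ₐ[k] C := e.symm.toAlgHom.comp ((θ : D →ₐ[k] A).codRestrict i.range h)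
  have ht (x : D) : i (t x) = θ x := congrArg Subtype.val (e.apply_symm_apply ⟨θ x, h x⟩)
  have ht' : i.comp t = θ := AlgHom.ext ht
  have h2 : Function.Injective (Algebra.TensorProduct.map i i) :=
    TensorProduct.map_injective_of_flat_flat i.toLinearMap i.toLinearMap hj hj
  refine ⟨.ofAlgHom t ?_ ?_, ht⟩
  · ext x
    change counit (R := k) (t x) = counit (R := k) x
    rw [← CoalgHomClass.counit_comp_apply j, ← CoalgHomClass.counit_comp_apply θ]
    exact congrArg _ (ht x)
  · refine (AlgHom.cancel_left h2).1 ?_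
    rw [← AlgHom.comp_assoc, ← Algebra.TensorProduct.map_comp, ht']
    ext x
    change TensorProduct.map (θ : D →ₗ[k] A) (θ : D →ₗ[k] A) (comul x) =
      TensorProduct.map (j : C →ₗ[k] A) (j : C →ₗ[k] A) (comul (t x))
    refine (CoalgHomClass.map_comp_comul_apply θ x).trans ?_
    refine Eq.trans ?_ (CoalgHomClass.map_comp_comul_apply j (t x)).symm
    exact congrArg _ (ht x).symm

namespace Coord

variable (c : Coord G A) (d : Coord H B) (q : Coord Q C) {φ : H ⟶ G} [IsMonHom φ]

theorem comap_comp (f : H ⟶ G) (g : G ⟶ Q) :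
    q.comap d (f ≫ g) = (c.comap d f).comp (q.comap c g) := by
  have h : q.pt B (toConv (q.comap d (f ≫ g))) =
      q.pt B (toConv ((c.comap d f).comp (q.comap c g))) := by
    rw [← q.univ_comp, ← Category.assoc, c.univ_comp, q.pt_comp_hom c]
  exact congrArg ofConv ((q.pt B).injective h)

theorem pt_convComp {R : Type u} [CommRing R] [Algebra k R] (h : WithConv (B →ₐ[k] R)) :
    c.pt R (convComp (c.comapBialgHom d φ) R h) = d.pt R h ≫ φ :=
  (c.pt_comp_hom d φ h).symm

/-- The points `y h z` and `y z` have the same image in `Q`, since `h` maps to `1`. -/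
theorem comap_mem_invariants (χ : G ⟶ Q) [IsMonHom χ] (hχ : φ ≫ χ = 1) (x : C) :
    q.comap c χ x ∈ invariants (c.comapBialgHom d φ) := by
  intro R _ _ y z h
  let θ := q.comapBialgHom c χ
  have h1 : convComp θ R (convComp (c.comapBialgHom d φ) R h) = 1 := by
    apply (q.pt R).injective
    rw [pt_convComp, pt_convComp, Category.assoc, hχ, MonObj.comp_one, map_one]
  have h2 : convComp θ R (y * convComp (c.comapBialgHom d φ) R h * z) = convComp θ R (y * z) := by
    rw [map_mul, map_mul, h1, mul_one, map_mul]
  exact AlgHom.congr_fun (congrArg ofConv h2) x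

/-- The group scheme of the Hopf algebra of invariant functions is a cokernel. -/
theorem isCokernel (π : G ⟶ Q) [IsMonHom π] (hj : Function.Injective (q.comap c π))
    (hr : ∀ a, a ∈ invariants (c.comapBialgHom d φ) ↔ ∃ x, q.comap c π x = a) :
    IsCokernel φ π where
  isAffine := q.isAffine
  isMonHom := inferInstance
  comp_eq_one := by
    rw [← cancel_epi d.univ, MonObj.comp_one, ← Category.assoc, c.univ_comp d, q.pt_comp_hom c,
      ← map_one (q.pt B)]
    congr 1
    refine congrArg toConv (AlgHom.ext fun x => ?_)
    -- Invariance at `x = y = 1` and the universal point of `H` says that an invariant function is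
    -- constant on `H`.
    have h1 := (hr _).2 ⟨x, rfl⟩ B 1 1 (toConv (AlgHom.id k B))
    rw [one_mul, mul_one, mul_one] at h1
    refine h1.trans ?_
    exact AlgHom.congr_fun (congrArg ofConv (q.comap_convOne c π (R := B))) x
  existsUnique_fac T _ _ χ _ hχ := by
    obtain ⟨D, _, _, ⟨t⟩⟩ := Coord.exists_of_isAffine T
    obtain ⟨θ, hθ⟩ := exists_bialgHom_lift (q.comapBialgHom c π) hj (t.comapBialgHom c χ)
      fun x => (hr _).1 (c.comap_mem_invariants d t χ hχ x)
    have h1 : t.comap q (t.homMk q (θ : D →ₐ[k] C)) = θ := t.comap_homMk q _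
    refine ⟨t.homMk q (θ : D →ₐ[k] C), ⟨t.isMonHom_of_comap q _ θ h1, ?_⟩, ?_⟩
    · apply t.hom_ext c
      rw [q.comap_comp c, h1]
      exact AlgHom.ext hθ
    · rintro χ' ⟨_, hχ'⟩
      apply t.hom_ext q
      rw [h1]
      refine AlgHom.ext fun x => hj ?_
      refine Eq.trans ?_ (hθ x).symm
      change ((q.comap c π).comp (t.comap q χ')) x = t.comap c χ x
      rw [← q.comap_comp c, hχ']

end Coord

end AffineGroupScheme

/-! ### Representations of the cokernel -/

namespace AffineGroupScheme

variable {k : Type u} [Field k]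

open MonoidalCategory CartesianMonoidalCategory TensorProduct Coalgebra WithConv
  Algebra.TensorProduct

variable {G H Q : Over (Spec (.of k))} [GrpObj G] [GrpObj H] [GrpObj Q] {A B C : Type u}
  [CommRing A] [HopfAlgebra k A] [CommRing B] [HopfAlgebra k B] [CommRing C] [HopfAlgebra k C]

theorem IsCokernel.exists_iso {Q' : Over (Spec (.of k))} [GrpObj Q'] {φ : H ⟶ G} {π : G ⟶ Q}
    {π' : G ⟶ Q'} (h : IsCokernel φ π) (h' : IsCokernel φ π') :
    ∃ e : Q ≅ Q', IsMonHom e.hom ∧ π ≫ e.hom = π' := by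
  have := h.isAffine
  have := h'.isAffine
  have := h.isMonHom
  have := h'.isMonHom
  obtain ⟨f, ⟨hf, hf'⟩, -⟩ := h.existsUnique_fac Q' π' h'.comp_eq_one
  obtain ⟨g, ⟨hg, hg'⟩, -⟩ := h'.existsUnique_fac Q π h.comp_eq_one
  refine ⟨⟨f, g, ?_, ?_⟩, hf, hf'⟩
  · exact (h.existsUnique_fac Q π h.comp_eq_one).unique
      ⟨inferInstance, by rw [← Category.assoc, hf', hg']⟩ ⟨inferInstance, Category.comp_id _⟩
  · exact (h'.existsUnique_fac Q' π' h'.comp_eq_one).unique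
      ⟨inferInstance, by rw [← Category.assoc, hg', hf']⟩ ⟨inferInstance, Category.comp_id _⟩

instance res_faithful (π : G ⟶ Q) [IsMonHom π] : (FDRep.res π).Faithful where
  map_injective {_ _ _ _} h := FDRep.Hom.ext <| by
    have := congrArg FDRep.Hom.toLinearMap h
    exact this

/-- Trivially acting subgroups act trivially on representations restricted from a quotient. -/
theorem isTrivial_of_essImage {φ : H ⟶ G} {π : G ⟶ Q} [IsMonHom φ] [IsMonHom π]
    (h : φ ≫ π = 1) (M : FDRep G) (hM : (FDRep.res π).essImage M) :
    ((FDRep.res φ).obj M).IsTrivial := by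
  obtain ⟨M', ⟨e⟩⟩ := hM
  intro R _ _ g
  have h1 : ((FDRep.res π).obj M').ρ R (g ≫ φ) = 1 := by
    change M'.ρ R ((g ≫ φ) ≫ π) = 1
    rw [Category.assoc, h, MonObj.comp_one, map_one]
  have h2 : e.hom.toLinearMap ∘ₗ e.inv.toLinearMap = LinearMap.id :=
    congrArg FDRep.Hom.toLinearMap e.inv_hom_id
  change M.ρ R (g ≫ φ) = 1
  refine LinearMap.ext fun x => ?_
  have hx : x = e.hom.toLinearMap.baseChange R (e.inv.toLinearMap.baseChange R x) := by
    rw [← LinearMap.comp_apply, ← LinearMap.baseChange_comp, h2, LinearMap.baseChange_id,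
      LinearMap.id_apply]
  have h3 := e.hom.comm R (g ≫ φ) (e.inv.toLinearMap.baseChange R x)
  rw [h1, Module.End.one_apply, ← hx] at h3
  exact h3.symm

namespace Coord

variable (c : Coord G A) (d : Coord H B) (q : Coord Q C)

/-- Equivariance under `Q` is one identity in `C ⊗ N.V`, at the universal point. It may be tested in
`A ⊗ N.V`, as `C → A` stays injective after tensoring; there it is equivariance under `G`. -/
theorem res_full (π : G ⟶ Q) [IsMonHom π] (hj : Function.Injective (q.comap c π)) :
    (FDRep.res π).Full where
  map_surjective {M N} f := by
    let F : M.V →ₗ[k] N.V := f.toLinearMap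
    have hbc {R S : Type u} [CommRing R] [Algebra k R] [CommRing S] [Algebra k S] (y : R →ₐ[k] S)
        (t : R ⊗[k] M.V) : F.baseChange S (y.toLinearMap.rTensor M.V t) =
          y.toLinearMap.rTensor N.V (F.baseChange R t) := by
      induction t with
      | zero => simp
      | add x y hx hy => simp only [map_add, hx, hy]
      | tmul r v => simp
    have hu (v : M.V) : F.baseChange C (M.ρ C q.univ (1 ⊗ₜ v)) = N.ρ C q.univ (1 ⊗ₜ F v) := by
      apply Module.Flat.rTensor_preserves_injective_linearMap (M := N.V)
        (q.comap c π).toLinearMap hj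
      rw [← hbc, ← M.ρ_map_one_tmul, ← N.ρ_map_one_tmul, q.specOverMap_univ, ← q.univ_comp c]
      exact (f.comm A c.univ (1 ⊗ₜ v)).trans
        (congrArg (N.ρ A (c.univ ≫ π)) (LinearMap.baseChange_tmul ..))
    refine ⟨⟨F, fun R _ _ g x => FDRep.comm_of_one_tmul F g (fun v => ?_) x⟩, rfl⟩
    obtain ⟨y, rfl⟩ := (q.pt R).surjective g
    rw [← toConv_ofConv y, ← q.specOverMap_univ, M.ρ_map_one_tmul, N.ρ_map_one_tmul, hbc, hu]

variable {φ : H ⟶ G} [IsMonHom φ]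

/-- Since `h` acts as the identity, `x h y` and `x y` have the same matrix. -/
theorem matrix_mem_invariants (M : FDRep G) (hM : ((FDRep.res φ).obj M).IsTrivial) {n : Type*}
    [Fintype n] [DecidableEq n] (b : Module.Basis n k M.V) (i l : n) :
    M.matrix b A c.univ i l ∈ invariants (c.comapBialgHom d φ) := by
  intro R _ _ x y h
  have h1 : M.matrix b R (c.pt R (convComp (c.comapBialgHom d φ) R h)) = 1 := by
    have : M.ρ R (d.pt R h ≫ φ) = 1 := hM R (d.pt R h)
    rw [pt_convComp, FDRep.matrix, MonoidHom.comp_apply, this, map_one]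
  have h2 : M.matrix b R (c.pt R (x * convComp (c.comapBialgHom d φ) R h * y)) =
      M.matrix b R (c.pt R (x * y)) := by
    rw [map_mul, map_mul, map_mul, map_mul, h1, mul_one, map_mul, map_mul]
  rw [c.matrix_pt, c.matrix_pt] at h2
  exact congrFun (congrFun h2 i) l

/-- The matrix of `M` has invariant entries, so it lifts to `C`. Injectivity of `C → A` and of its
tensor square makes the lift a comatrix, which defines a representation of `Q` on the same space. -/
theorem essImage_of_isTrivial (π : G ⟶ Q) [IsMonHom π] (hj : Function.Injective (q.comap c π))
    (hr : ∀ a, a ∈ invariants (c.comapBialgHom d φ) → ∃ x, q.comap c π x = a) (M : FDRep G)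
    (hM : ((FDRep.res φ).obj M).IsTrivial) : (FDRep.res π).essImage M := by
  let β := Module.finBasis k M.V
  choose E hE using fun i l => hr _ (c.matrix_mem_invariants d M hM β i l)
  have hD := c.isComatrix_matrix M β
  let j := q.comapBialgHom c π
  have hE' (i l) : j (E i l) = M.matrix β A c.univ i l := hE i l
  have h2 : Function.Injective (TensorProduct.map (j : C →ₗ[k] A) (j : C →ₗ[k] A)) :=
    TensorProduct.map_injective_of_flat_flat _ _ hj hj
  have hEc : IsComatrix (k := k) (Matrix.of E) :=
    { comul := fun i l => by
        apply h2
        refine (CoalgHomClass.map_comp_comul_apply j (E i l)).trans ?_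
        rw [hE', hD.comul, map_sum]
        exact Finset.sum_congr rfl fun x _ => congrArg₂ _ (hE' i x).symm (hE' x l).symm
      counit := fun i l => by
        refine (CoalgHomClass.counit_comp_apply j (E i l)).symm.trans ?_
        rw [hE', hD.counit] }
  have hρ (R : Type u) [CommRing R] [Algebra k R] (g : specOver k R ⟶ G) :
      (show Module.End R (R ⊗[k] M.V) from (q.rep β hEc).ρ R (g ≫ π)) = M.ρ R g := by
    obtain ⟨x, rfl⟩ := (c.pt R).surjective g
    refine (Algebra.TensorProduct.basis R β).ext fun l => ?_
    rw [Algebra.TensorProduct.basis_apply, q.pt_comp_hom c, M.ρ_one_tmul_basis, c.matrix_pt]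
    refine (q.rep_ρ_one_tmul β hEc _ l).trans ?_
    exact Finset.sum_congr rfl fun i _ => congrArg (fun a => x.ofConv a ⊗ₜ[k] β i) (hE i l)
  have hid (R : Type u) [CommRing R] [Algebra k R] (y : R ⊗[k] M.V) :
      (LinearMap.id : M.V →ₗ[k] M.V).baseChange R y = y := by
    rw [LinearMap.baseChange_id]
    rfl
  refine ⟨q.rep β hEc, ⟨⟨⟨LinearMap.id (M := M.V), fun R _ _ g x => ?_⟩,
    ⟨LinearMap.id (M := M.V), fun R _ _ g x => ?_⟩, FDRep.Hom.ext rfl, FDRep.Hom.ext rfl⟩⟩⟩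
  · exact (hid R _).trans ((LinearMap.congr_fun (hρ R g) x).trans
      (congrArg (M.ρ R g) (hid R x)).symm)
  · exact (hid R _).trans ((LinearMap.congr_fun (hρ R g) x).symm.trans
      (congrArg (show Module.End R (R ⊗[k] M.V) from (q.rep β hEc).ρ R (g ≫ π)) (hid R x)).symm)

end Coord

end AffineGroupScheme

/-! ### Transport to an arbitrary cokernel, and the theorem -/

namespace AffineGroupScheme

theorem Coord.comap_ofIso {k : Type u} [Field k] {G Q Q' : Over (Spec (.of k))} [GrpObj G]
    [GrpObj Q] [GrpObj Q'] {A C : Type u} [CommRing A] [HopfAlgebra k A] [CommRing C]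
    [HopfAlgebra k C] (q : Coord Q C) (c : Coord G A) (e : Q ≅ Q') [IsMonHom e.hom] (π : G ⟶ Q) :
    (q.ofIso e).comap c (π ≫ e.hom) = q.comap c π := by
  refine congrArg WithConv.ofConv (((q.ofIso e).pt A).symm_apply_eq.2 ?_)
  change _ = q.pt A ((q.pt A).symm (c.univ ≫ π)) ≫ e.hom
  rw [MulEquiv.apply_symm_apply, Category.assoc]

/-- The spectrum of the algebra of invariants is a cokernel, and its coordinate algebra serves for
every cokernel. -/
theorem Coord.exists_isCokernel {k : Type u} [Field k] {G H : Over (Spec (.of k))} [GrpObj G]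
    [GrpObj H] {A B : Type u} [CommRing A] [HopfAlgebra k A] [CommRing B]
    [HopfAlgebra k B] (c : Coord G A) (d : Coord H B) (φ : H ⟶ G) [IsMonHom φ] :
    ∃ (C : Type u) (_ : CommRing C) (_ : HopfAlgebra k C) (Q : Over (Spec (.of k))) (_ : GrpObj Q)
      (q : Coord Q C) (π : G ⟶ Q), IsCokernel φ π ∧ Function.Injective (q.comap c π) ∧
        ∀ a, a ∈ invariants (c.comapBialgHom d φ) ↔ ∃ x, q.comap c π x = a := by
  obtain ⟨C, _, _, j, hj, hr⟩ := exists_hopfAlgebra_invariants (c.comapBialgHom d φ)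
  let _ : GrpObj (specOver k C) := instGrpObjSpecAsOverSpec (R := .of k) (A := .of C)
  let q : Coord (specOver k C) C := Coord.spec C
  have hc : q.comap c (q.homMk c (j : C →ₐ[k] A)) = j := q.comap_homMk c _
  have : IsMonHom (q.homMk c (j : C →ₐ[k] A)) := q.isMonHom_of_comap c _ j hc
  have hj' : Function.Injective (q.comap c (q.homMk c (j : C →ₐ[k] A))) := by
    rw [hc]
    exact hj
  have hr' (a : A) : a ∈ invariants (c.comapBialgHom d φ) ↔
      ∃ x, q.comap c (q.homMk c (j : C →ₐ[k] A)) x = a := by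
    rw [hc, hr]
    rfl
  exact ⟨C, _, _, _, _, q, _, c.isCokernel d q _ hj' hr', hj', hr'⟩

end AffineGroupScheme

end

theorem mainTheorem8 {k : Type u} [Field k] {H G : Over (Spec (.of k))} [GrpObj H] [GrpObj G]
    [IsAffine H.left] [IsAffine G.left] (φ : H ⟶ G) [IsMonHom φ]
    (ind : AffineGroupScheme.FDRep H ⥤ AffineGroupScheme.FDRep G)
    (adj : AffineGroupScheme.FDRep.res φ ⊣ ind) [ind.Faithful]
    (htriv : ((AffineGroupScheme.FDRep.res φ).obj
      (ind.obj (AffineGroupScheme.FDRep.unit H))).IsTrivial) :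
    IsClosedImmersion φ.left ∧ IsMonHom.Normal φ ∧
      (∃ (Q : Over (Spec (.of k))) (_ : GrpObj Q) (π : G ⟶ Q),
        AffineGroupScheme.IsCokernel φ π) ∧
      ∀ (Q : Over (Spec (.of k))) [GrpObj Q] (π : G ⟶ Q) [IsMonHom π],
        AffineGroupScheme.IsCokernel φ π →
          (AffineGroupScheme.FDRep.res π).Full ∧ (AffineGroupScheme.FDRep.res π).Faithful ∧
            ∀ M : AffineGroupScheme.FDRep G, (AffineGroupScheme.FDRep.res π).essImage M ↔
              ((AffineGroupScheme.FDRep.res φ).obj M).IsTrivial := by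
  obtain ⟨A, _, _, ⟨c⟩⟩ := AffineGroupScheme.Coord.exists_of_isAffine G
  obtain ⟨B, _, _, ⟨d⟩⟩ := AffineGroupScheme.Coord.exists_of_isAffine H
  have hφ := AffineGroupScheme.resCoversReps_of_adjunction φ adj
  obtain ⟨C, _, _, Q₀, _, q₀, π₀, h₀, hj, hr⟩ := c.exists_isCokernel d φ
  refine ⟨c.isClosedImmersion d φ (c.comap_surjective d hφ), c.normal_of_adjunction d adj htriv,
    ⟨Q₀, _, π₀, h₀⟩, fun Q _ π _ hπ => ?_⟩
  -- Cokernels are unique up to isomorphism, so the coordinates of the constructed one carry over to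
  -- `Q` with the same map into `A`.
  obtain ⟨e, _, rfl⟩ := h₀.exists_iso hπ
  have he := q₀.comap_ofIso c e π₀
  rw [← he] at hj
  simp only [← he] at hr
  exact ⟨c.res_full (q₀.ofIso e) _ hj, AffineGroupScheme.res_faithful _, fun M =>
    ⟨AffineGroupScheme.isTrivial_of_essImage hπ.comp_eq_one M,
      c.essImage_of_isTrivial d (q₀.ofIso e) _ hj (fun a => (hr a).1) M⟩⟩
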